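/- Let $G$ be a group that is the amalgamated product $G=G_1*_ZG_2$ of subgroups $G_1,G_2$ over a common subgroup $Z$, where $G_1\neq Z\neq G_2$ and $Z$ is virtually $\mathbb{Z}$ (i.e. has an infinite cyclic subgroup of finite index). Let $G$ act geometrically, i.e. by isometries, properly ($\{g\in G: gK\cap K\neq\emptyset\}$ is finite for every compact $K\subseteq X$) and cocompactly (the quotient $G\backslash X$ is compact), on a non-empty proper metric space $(X,d)$. Let $\sigma\colon X\times X\times[0,1]\to X$ be a geodesic bicombing, that is, a continuous map such that each $\sigma_{xy}=\sigma(x,y,\cdot)$ is a constant speed geodesic from $x$ to $y$. Assume that $\sigma$ is $\mathfrak{ccc}$, i.e. consistent ($\mathrm{im}\,\sigma_{\sigma_{xy}(s),\sigma_{xy}(t)}=\sigma_{xy}([s,t])$ for all $x,y\in X$ and $0\le s<t\le 1$) and conical ($d(\sigma_{xy}(t),\sigma_{x'y'}(t))\le(1-t)d(x,x')+t\,d(y,y')$ for all $x,y,x',y'\in X$ and $t\in[0,1]$), and hence convex, i.e. $t\mapsto d(\sigma_{xy}(t),\sigma_{x'y'}(t))$ is convex; that it is reversible ($\sigma_{xy}(t)=\sigma_{yx}(1-t)$);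 and that it is $G$-equivariant ($g\,\sigma_{xy}(t)=\sigma_{gx,gy}(t)$ for all $g\in G$). A $\sigma$-ray is an isometric embedding $\xi\colon[0,\infty)\to X$ with $\mathrm{im}\,\sigma_{\xi(0)\xi(t)}=\xi([0,t])$ for all $t\ge 0$; two $\sigma$-rays $\xi,\zeta$ are asymptotic if $\sup_{t\ge 0}d(\xi(t),\zeta(t))<\infty$. The boundary $\partial_\sigma X$ is the set of asymptoty classes of $\sigma$-rays. For a basepoint $o\in X$, its topology is generated by the sets $$\{[\eta] : \eta \text{ a }\sigma\text{-ray},\ \eta(0)=o,\ d(\eta(t),\xi(t))<\epsilon\},$$ where $\xi$ is a $\sigma$-ray with $\xi(0)=o$, $t\ge 0$ and $\epsilon>0$; this topology does not depend on $o$. Then there exists a separating pair of points in $\partial_\sigma X$, i.e. there are two distinct points $a,b\in\partial_\sigma X$ such that $\partial_\sigma X\setminus\{a,b\}$ is disconnected. -/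

import Mathlib

open scoped NNReal

section GeometricAction

/-- An action of a (discrete) group on a metric space is geometric if it is by isometries, proper
(only finitely many translates of a compact set `K` meet `K`) and cocompact (the orbit space is
compact). -/
structure IsGeometricAction (G : Type*) (X : Type*) [Group G] [MetricSpace X] [MulAction G X] :
    Prop where
  isometric : ∀ g : G, Isometry fun x : X => g • x
  proper : ∀ K : Set X, IsCompact K → {g : G | ((fun x => g • x) '' K ∩ K).Nonempty}.Finite
  cocompact : CompactSpace (Quotient (MulAction.orbitRel G X))

end GeometricAction

section Groups

/-- A group is virtually `ℤ` if it has an infinite cyclic subgroup of finite index. -/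
def IsVirtuallyInt (Z : Type*) [Group Z] : Prop :=
  ∃ M : Subgroup Z, M.FiniteIndex ∧ Nonempty (M ≃* Multiplicative ℤ)

/-- The canonical homomorphism from the amalgamated product `A 0 *_Z A 1` (the pushout of the
inclusions `Z ↪ A 0` and `Z ↪ A 1`) to `G`, for subgroups `A 0`, `A 1` of `G` that contain the
subgroup `Z`. -/
def amalgamMap {G : Type*} [Group G] (A : Fin 2 → Subgroup G) (Z : Subgroup G)
    (h : ∀ i, Z ≤ A i) : Monoid.PushoutI (fun i => Subgroup.inclusion (h i)) →* G :=
  Monoid.PushoutI.lift (fun i => (A i).subtype) Z.subtype fun _ => rfl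

/-- `G = G₁ *_Z G₂`: the subgroup `Z` is contained in the subgroups `G₁` and `G₂` of `G`, and the
canonical homomorphism from the amalgamated product of `G₁` and `G₂` over `Z` to `G` is an
isomorphism. -/
def IsAmalgamatedProduct {G : Type*} [Group G] (G₁ G₂ Z : Subgroup G) : Prop :=
  ∃ h : ∀ i, Z ≤ ![G₁, G₂] i, Function.Bijective (amalgamMap ![G₁, G₂] Z h)

end Groups

section Bicombings

/-- A (geodesic) bicombing on `X`: a continuous map `σ : X × X × [0,1] → X` such that each
`σ x y` is a constant speed geodesic from `x` to `y`. -/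
structure Bicombing (X : Type*) [MetricSpace X] where
  toFun : X → X → unitInterval → X
  continuous_toFun : Continuous fun p : X × X × unitInterval => toFun p.1 p.2.1 p.2.2
  map_zero : ∀ x y, toFun x y 0 = x
  map_one : ∀ x y, toFun x y 1 = y
  dist_map : ∀ x y (s t : unitInterval),
    dist (toFun x y s) (toFun x y t) = |(s : ℝ) - (t : ℝ)| * dist x y

namespace Bicombing

variable {X : Type*} [MetricSpace X]

instance : CoeFun (Bicombing X) fun _ => X → X → unitInterval → X := ⟨Bicombing.toFun⟩

/-- The `σ`-geodesic between two points of a `σ`-geodesic is the part of it between them. -/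
def IsConsistent (σ : Bicombing X) : Prop :=
  ∀ (x y : X) (s t : unitInterval), s < t →
    Set.range (σ (σ x y s) (σ x y t)) = σ x y '' Set.Icc s t

def IsConical (σ : Bicombing X) : Prop :=
  ∀ (x y x' y' : X) (t : unitInterval),
    dist (σ x y t) (σ x' y' t) ≤ (1 - (t : ℝ)) * dist x x' + (t : ℝ) * dist y y'

/-- A ccc bicombing: consistent and conical. (Such a bicombing is automatically convex.) -/
def IsCCC (σ : Bicombing X) : Prop := σ.IsConsistent ∧ σ.IsConical

def IsReversible (σ : Bicombing X) : Prop :=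
  ∀ (x y : X) (t : unitInterval), σ x y t = σ y x (unitInterval.symm t)

def IsEquivariant (σ : Bicombing X) (G : Type*) [Group G] [MulAction G X] : Prop :=
  ∀ (g : G) (x y : X) (t : unitInterval), g • σ x y t = σ (g • x) (g • y) t

/-- A `σ`-ray: an isometric embedding `ξ : [0,∞) → X` whose initial segments are, as sets,
`σ`-geodesics. -/
structure Ray (σ : Bicombing X) where
  toFun : ℝ≥0 → X
  isometry : Isometry toFun
  range_eq : ∀ t : ℝ≥0, Set.range (σ (toFun 0) (toFun t)) = toFun '' Set.Icc 0 t

instance (σ : Bicombing X) : CoeFun σ.Ray fun _ => ℝ≥0 → X := ⟨Ray.toFun⟩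

/-- Two `σ`-rays are asymptotic if they stay at bounded distance from each other. -/
def asymptotic (σ : Bicombing X) : Setoid σ.Ray where
  r ξ ζ := ∃ C : ℝ, ∀ t : ℝ≥0, dist (ξ t) (ζ t) ≤ C
  iseqv :=
    { refl := fun _ => ⟨0, fun _ => (dist_self _).le⟩
      symm := fun ⟨C, h⟩ => ⟨C, fun t => (dist_comm _ _).trans_le (h t)⟩
      trans := fun ⟨C, h⟩ ⟨D, k⟩ =>
        ⟨C + D, fun t => (dist_triangle _ _ _).trans (add_le_add (h t) (k t))⟩ }

/-- The boundary `∂_σ X`, as a set: the asymptoty classes of `σ`-rays. -/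
def Boundary (σ : Bicombing X) : Type _ := Quotient σ.asymptotic

/-- The asymptoty class of a `σ`-ray. -/
def Ray.toBoundary {σ : Bicombing X} (ξ : σ.Ray) : σ.Boundary := Quotient.mk σ.asymptotic ξ

/-- The basic set `U_o([ξ], t, ε)`, where `ξ` is a `σ`-ray and `o = ξ 0`: the boundary points whose
representative `η` issuing from `o` satisfies `dist (η t) (ξ t) < ε`. -/
def basicNhd (σ : Bicombing X) (ξ : σ.Ray) (t : ℝ≥0) (ε : ℝ) : Set σ.Boundary :=
  {b | ∃ η : σ.Ray, η 0 = ξ 0 ∧ η.toBoundary = b ∧ dist (η t) (ξ t) < ε}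

/-- The topology of `∂_σ X`, constructed from the basepoint `o`. -/
@[reducible] def boundaryTopology (σ : Bicombing X) (o : X) : TopologicalSpace σ.Boundary :=
  TopologicalSpace.generateFrom
    {U | ∃ (ξ : σ.Ray) (t : ℝ≥0) (ε : ℝ), ξ 0 = o ∧ 0 < ε ∧ U = σ.basicNhd ξ t ε}

end Bicombing

end Bicombings

/-- `a`, `b` is a separating pair of points of the topological space `(T, τ)`: they are distinct and
the complement of `{a, b}` is disconnected. -/
def IsSeparatingPair {T : Type*} (τ : TopologicalSpace T) (a b : T) : Prop :=
  a ≠ b ∧ ¬ @IsPreconnected T τ ({a, b}ᶜ)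

/-!
An element `γ` of `Z` of infinite order has a `σ`-axis `c`: a fixed point of the map sending `y` to
the midpoint of `γ⁻¹ • y` and `γ • y` lies on one. The normal form in `G₁ *_Z G₂` yields a subset
`U` of `G` that every right translation changes only in finitely many cosets of `Z`, hence of `⟨γ⟩`.
So neighbourhoods of `U • o` and of `Uᶜ • o` form an open cover of `X` whose overlap stays at
bounded distance from `c`. By convexity a ray that has left a large neighbourhood of `c` never
returns to it, and so it stays on one of the two sides from then on; this splits the boundary minus
the two ends of `c` into two open sets. For `a ∈ G₁ \ Z` and `b ∈ G₂ \ Z`, the axes of `a * b` and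
`b * a` diverge from `c` on different sides, so both sets are nonempty.
-/

section AlmostInvariantSets

open scoped Pointwise

variable {G : Type*} [Group G] {H K : Subgroup G} {S T U : Set G}

/-- A subset of `G` is `H`-finite if finitely many right cosets `H * g` cover it. -/
def IsCosetFinite (H : Subgroup G) (S : Set G) : Prop :=
  ∃ F : Set G, F.Finite ∧ S ⊆ H * F

namespace IsCosetFinite

theorem mono (hT : IsCosetFinite H T) (hST : S ⊆ T) : IsCosetFinite H S :=
  let ⟨F, hF, hTF⟩ := hT
  ⟨F, hF, hST.trans hTF⟩

theorem biUnion {ι : Type*} {s : Set ι} (hs : s.Finite) {T : ι → Set G}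
    (hT : ∀ i, IsCosetFinite H (T i)) : IsCosetFinite H (⋃ i ∈ s, T i) := by
  choose F hF hTF using hT
  refine ⟨⋃ i ∈ s, F i, hs.biUnion fun i _ => hF i, Set.iUnion₂_subset fun i hi => ?_⟩
  exact (hTF i).trans (Set.mul_subset_mul_left (Set.subset_biUnion_of_mem hi))

theorem union (hS : IsCosetFinite H S) (hT : IsCosetFinite H T) : IsCosetFinite H (S ∪ T) := by
  obtain ⟨E, hE, hSE⟩ := hS
  obtain ⟨F, hF, hTF⟩ := hT
  exact ⟨E ∪ F, hE.union hF, by rw [Set.mul_union]; exact Set.union_subset_union hSE hTF⟩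

theorem self (H : Subgroup G) : IsCosetFinite H (H : Set G) :=
  ⟨{1}, Set.finite_singleton 1, by simp⟩

theorem preimage_mul_right (hS : IsCosetFinite H S) (k : G) :
    IsCosetFinite H ((· * k) ⁻¹' S) := by
  obtain ⟨F, hF, hSF⟩ := hS
  refine ⟨F * {k⁻¹}, hF.mul (Set.finite_singleton _), fun g hg => ?_⟩
  rw [← mul_assoc]
  exact ⟨g * k, hSF hg, k⁻¹, rfl, mul_inv_cancel_right g k⟩

theorem trans (hK : IsCosetFinite H (K : Set G)) (hS : IsCosetFinite K S) :
    IsCosetFinite H S := by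
  obtain ⟨E, hE, hKE⟩ := hK
  obtain ⟨F, hF, hSF⟩ := hS
  refine ⟨E * F, hE.mul hF, hSF.trans ?_⟩
  rw [← mul_assoc]
  exact Set.mul_subset_mul_right hKE

theorem exists_pow_notMem (hS : IsCosetFinite H S) {g : G} (hg : ∀ n : ℕ, g ^ (n + 1) ∉ H) :
    ∃ n : ℕ, g ^ (n + 1) ∉ S := by
  by_contra! hmem
  obtain ⟨F, hF, hSF⟩ := hS
  choose z hz f hf hzf using fun n => hSF (hmem n)
  obtain ⟨m, n, hmn, hfmn⟩ := Set.Finite.exists_lt_map_eq_of_forall_mem hf hF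
  have hquot : g ^ (n - m - 1 + 1) = z n * (z m)⁻¹ := calc
    g ^ (n - m - 1 + 1) = g ^ (n + 1) * (g ^ (m + 1))⁻¹ := by
      rw [eq_mul_inv_iff_mul_eq, ← pow_add]; congr 1; omega
    _ = z n * (z m)⁻¹ := by rw [← hzf n, ← hzf m, hfmn]; group
  exact hg _ (hquot ▸ H.mul_mem (hz n) (H.inv_mem (hz m)))

end IsCosetFinite

theorem isCosetFinite_map_subtype (M : Subgroup K) [M.FiniteIndex] :
    IsCosetFinite (M.map K.subtype) (K : Set G) := by
  obtain ⟨F, hF, -⟩ := M.exists_isComplement_right 1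
  have hfin : F.Finite := hF.finite_right_iff.2 inferInstance
  refine ⟨K.subtype '' F, hfin.image _, ?_⟩
  rw [Subgroup.coe_map, ← Set.image_mul, hF.mul_eq, Set.image_univ]
  exact Subtype.range_coe.ge

theorem IsVirtuallyInt.exists_isCosetFinite_zpowers {Z : Subgroup G} (hZ : IsVirtuallyInt Z) :
    ∃ γ ∈ Z, ¬ IsOfFinOrder γ ∧ IsCosetFinite (Subgroup.zpowers γ) (Z : Set G) := by
  obtain ⟨M, hM, ⟨e⟩⟩ := hZ
  have : IsCyclic M := isCyclic_of_surjective e.symm e.symm.surjective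
  have : Infinite M := e.toEquiv.infinite_iff.2 inferInstance
  obtain ⟨m, hm⟩ := IsCyclic.exists_generator (α := M)
  have hmap : Subgroup.zpowers ((m : Z) : G) = M.map Z.subtype := by
    have hgen : (Subgroup.zpowers m).map M.subtype = M := by
      rw [(Subgroup.eq_top_iff' _).2 hm, ← MonoidHom.range_eq_map, M.range_subtype]
    calc Subgroup.zpowers ((m : Z) : G) = ((Subgroup.zpowers m).map M.subtype).map Z.subtype := by
          rw [MonoidHom.map_zpowers, MonoidHom.map_zpowers]; rfl
      _ = M.map Z.subtype := by rw [hgen]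
  refine ⟨(m : Z), (m : Z).2, ?_, hmap ▸ isCosetFinite_map_subtype M⟩
  rw [Submonoid.isOfFinOrder_coe, Submonoid.isOfFinOrder_coe, ← orderOf_eq_zero_iff]
  exact Infinite.orderOf_eq_zero_of_forall_mem_zpowers hm

/-- A subset of `G` is almost invariant over `H` if each right translation changes it only in an
`H`-finite set. (Left invariance under `H` is not part of the definition.) -/
def IsAlmostInvariant (H : Subgroup G) (U : Set G) : Prop :=
  ∀ k, IsCosetFinite H {g | ¬ (g * k ∈ U ↔ g ∈ U)}

namespace IsAlmostInvariant

theorem compl (hU : IsAlmostInvariant H U) : IsAlmostInvariant H Uᶜ := fun k => by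
  simpa only [Set.mem_compl_iff, not_iff_not] using hU k

theorem trans (hK : IsCosetFinite H (K : Set G)) (hU : IsAlmostInvariant K U) :
    IsAlmostInvariant H U :=
  fun k => hK.trans (hU k)

end IsAlmostInvariant

theorem IsCosetFinite.translation_mul {k l : G} (hk : IsCosetFinite H {g | ¬ (g * k ∈ U ↔ g ∈ U)})
    (hl : IsCosetFinite H {g | ¬ (g * l ∈ U ↔ g ∈ U)}) :
    IsCosetFinite H {g | ¬ (g * (k * l) ∈ U ↔ g ∈ U)} := by
  refine (hk.union (hl.preimage_mul_right k)).mono fun g hg => ?_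
  by_contra hcon
  simp only [Set.mem_union, Set.mem_preimage, Set.mem_ofPred_eq, not_or, not_not] at hcon
  exact hg (by rw [← mul_assoc, hcon.2, hcon.1])

end AlmostInvariantSets

section Amalgam

open Monoid

variable {G : Type*} [Group G] {A : Fin 2 → Subgroup G} {Z : Subgroup G} {h : ∀ i, Z ≤ A i}

theorem amalgamMap_of {i : Fin 2} (a : A i) :
    amalgamMap A Z h (PushoutI.of (φ := fun i => Subgroup.inclusion (h i)) i a) = a :=
  PushoutI.lift_of (fun i => (A i).subtype) Z.subtype (fun _ => rfl) a

theorem amalgamMap_base (z : Z) :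
    amalgamMap A Z h (PushoutI.base (fun i => Subgroup.inclusion (h i)) z) = z :=
  PushoutI.lift_base (fun i => (A i).subtype) Z.subtype (fun _ => rfl) z

theorem amalgam_induction (hsurj : Function.Surjective (amalgamMap A Z h)) {P : G → Prop}
    (mem : ∀ i, ∀ a ∈ A i, P a) (mul : ∀ a b, P a → P b → P (a * b)) (g : G) : P g := by
  obtain ⟨x, rfl⟩ := hsurj g
  induction x using PushoutI.induction_on with
  | of i a => rw [amalgamMap_of]; exact mem i a a.2
  | base z => rw [amalgamMap_base]; exact mem 0 z (h 0 z.2)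
  | mul x y hx hy => rw [map_mul]; exact mul _ _ hx hy

variable (h) in
/-- `g` is the value of a reduced word of the amalgamated product whose first letter lies in
`A i`. -/
def StartsIn (i : Fin 2) (g : G) : Prop :=
  ∃ w : CoprodI.Word fun i => A i, PushoutI.Reduced (fun i => Subgroup.inclusion (h i)) w ∧
    w.fstIdx = some i ∧ amalgamMap A Z h (PushoutI.ofCoprodI w.prod) = g

namespace StartsIn

theorem notMem (hinj : Function.Injective (amalgamMap A Z h)) {i : Fin 2} {g : G}
    (hg : StartsIn h i g) : g ∉ Z := by
  obtain ⟨w, hw, hi, rfl⟩ := hg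
  intro hz
  have hempty := hw.eq_empty_of_mem_range (fun i => Subgroup.inclusion_injective (h i))
    ⟨⟨_, hz⟩, hinj (amalgamMap_base _)⟩
  simp [hempty, CoprodI.Word.fstIdx, CoprodI.Word.empty] at hi

theorem mul_word {i : Fin 2} {a : G} (ha : a ∈ A i) (haZ : a ∉ Z) {w : CoprodI.Word fun i => A i}
    (hw : PushoutI.Reduced (fun i => Subgroup.inclusion (h i)) w) (hi : w.fstIdx ≠ some i) :
    StartsIn h i (a * amalgamMap A Z h (PushoutI.ofCoprodI w.prod)) := by
  have hrange : (⟨a, ha⟩ : A i) ∉ (Subgroup.inclusion (h i)).range := by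
    rintro ⟨z, hz⟩
    have hza : (z : G) = a := congrArg Subtype.val hz
    exact haZ (hza ▸ z.2)
  refine ⟨CoprodI.Word.cons ⟨a, ha⟩ w hi fun h1 => hrange (h1 ▸ one_mem _), ?_, by simp, ?_⟩
  · exact List.forall_mem_cons.2 ⟨hrange, hw⟩
  · rw [CoprodI.Word.prod_cons, map_mul, map_mul, PushoutI.ofCoprodI_of, amalgamMap_of]

theorem of_mem {i : Fin 2} {a : G} (ha : a ∈ A i) (haZ : a ∉ Z) : StartsIn h i a := by
  simpa using mul_word (h := h) ha haZ (w := CoprodI.Word.empty)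
    (by simp [PushoutI.Reduced, CoprodI.Word.empty])
    (by simp [CoprodI.Word.fstIdx, CoprodI.Word.empty])

theorem mul {i j : Fin 2} (hij : i ≠ j) {a g : G} (ha : a ∈ A i) (haZ : a ∉ Z)
    (hg : StartsIn h j g) : StartsIn h i (a * g) := by
  obtain ⟨w, hw, hj, rfl⟩ := hg
  exact mul_word ha haZ hw (by simpa [hj] using hij.symm)

variable {i j : Fin 2} {a b : G}

theorem pow_mul (hij : i ≠ j) (ha : a ∈ A i) (haZ : a ∉ Z) (hb : b ∈ A j) (hbZ : b ∉ Z) (n : ℕ) :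
    StartsIn h i ((a * b) ^ n * a) := by
  induction n with
  | zero => simpa using of_mem ha haZ
  | succ n ih =>
    rw [_root_.pow_succ', mul_assoc, mul_assoc]
    exact .mul hij ha haZ (.mul hij.symm hb hbZ ih)

theorem pow_succ (hij : i ≠ j) (ha : a ∈ A i) (haZ : a ∉ Z) (hb : b ∈ A j) (hbZ : b ∉ Z) (n : ℕ) :
    StartsIn h i ((a * b) ^ (n + 1)) := by
  rw [_root_.pow_succ, ← mul_assoc, mul_pow_mul, mul_assoc]
  exact .mul hij ha haZ (.pow_mul hij.symm hb hbZ ha haZ n)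

end StartsIn

/-- The action of `G` on `G × M` by right translations of the first factor, conjugated by the shear
`(g, m) ↦ (g, m + d g)`. -/
def shearedTranslation {M : Type*} [AddCommGroup M] (d : G → M) : G →* Equiv.Perm (G × M) where
  toFun a :=
    { toFun := fun p => (p.1 * a⁻¹, p.2 - d p.1 + d (p.1 * a⁻¹))
      invFun := fun p => (p.1 * a, p.2 - d p.1 + d (p.1 * a))
      left_inv := fun p => by simp
      right_inv := fun p => by simp }
  map_one' := by ext p <;> simp
  map_mul' a b := by ext p <;> simp [mul_assoc]

-- The actions of the factors on `G × M`, sheared along `d i`, agree on `Z`, so they extend to `G`.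
theorem exists_glued_cochain (hbij : Function.Bijective (amalgamMap A Z h)) {M : Type*}
    [AddCommGroup M] (d : Fin 2 → G → M) (hd : ∀ i, ∀ z ∈ Z, ∀ g, d i (g * z) = d i g) :
    ∃ χ : G → M, χ 1 = 0 ∧ ∀ i, ∀ a ∈ A i, ∀ g, χ (g * a) = χ g - d i g + d i (g * a) := by
  let e := MulEquiv.ofBijective (amalgamMap A Z h) hbij
  have hagree : ∀ i, ((shearedTranslation (d i)).comp (A i).subtype).comp
      (Subgroup.inclusion (h i)) = (shearedTranslation (0 : G → M)).comp Z.subtype := by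
    intro i
    ext z p <;> simp [shearedTranslation, hd i _ (Z.inv_mem z.2)]
  let Φ : G →* Equiv.Perm (G × M) := (PushoutI.lift _ _ hagree).comp e.symm.toMonoidHom
  have hΦ : ∀ i, ∀ a ∈ A i, Φ a = shearedTranslation (d i) a := by
    intro i a ha
    have hof : e.symm a = PushoutI.of i ⟨a, ha⟩ :=
      e.symm_apply_eq.2 (amalgamMap_of (h := h) ⟨a, ha⟩).symm
    change PushoutI.lift _ _ hagree (e.symm a) = _
    rw [hof, PushoutI.lift_of]
    rfl
  have hfst : ∀ k, ∀ p, (Φ k p).1 = p.1 * k⁻¹ := by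
    refine amalgam_induction hbij.2 (fun i a ha p => by rw [hΦ i a ha]; rfl)
      fun a b ha hb p => ?_
    rw [map_mul, Equiv.Perm.mul_apply, ha, hb, mul_inv_rev, mul_assoc]
  refine ⟨fun k => (Φ k⁻¹ (1, 0)).2, by simp, fun i a ha g => ?_⟩
  have hg : (Φ g⁻¹ (1, 0)).1 = g := by rw [hfst, one_mul, inv_inv]
  dsimp only
  rw [mul_inv_rev, map_mul, hΦ i _ (inv_mem ha), Equiv.Perm.mul_apply]
  simp only [shearedTranslation, MonoidHom.coe_mk, OneHom.coe_mk, inv_inv, Equiv.coe_fn_mk, hg]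

theorem apply_pow_mul_eq (hinj : Function.Injective (amalgamMap A Z h)) {M : Type*} {χ : G → M}
    (hχ : ∀ i, ∀ a ∈ A i, ∀ g ∉ Z, g * a ∉ Z → χ (g * a) = χ g) {i j : Fin 2} (hij : i ≠ j)
    {a b : G} (ha : a ∈ A i) (haZ : a ∉ Z) (hb : b ∈ A j) (hbZ : b ∉ Z) (n : ℕ) :
    χ ((a * b) ^ n * a) = χ a ∧ χ ((a * b) ^ (n + 1)) = χ a := by
  have hodd (n) : (a * b) ^ n * a ∉ Z := (StartsIn.pow_mul hij ha haZ hb hbZ n).notMem hinj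
  have heven (n) : (a * b) ^ (n + 1) ∉ Z := (StartsIn.pow_succ hij ha haZ hb hbZ n).notMem hinj
  have happend (n) : χ ((a * b) ^ (n + 1)) = χ ((a * b) ^ n * a) := by
    rw [pow_succ, ← mul_assoc]
    exact hχ j b hb _ (hodd n) (by rw [mul_assoc, ← pow_succ]; exact heven n)
  suffices hconst : χ ((a * b) ^ n * a) = χ a from ⟨hconst, (happend n).trans hconst⟩
  induction n with
  | zero => simp
  | succ n ih => rw [hχ i a ha _ (heven n) (hodd (n + 1)), happend, ih]

theorem isAlmostInvariant_of_forall_mem (hsurj : Function.Surjective (amalgamMap A Z h))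
    {U : Set G} (hU : ∀ i, ∀ a ∈ A i, ∀ g ∉ Z, g * a ∉ Z → (g * a ∈ U ↔ g ∈ U)) :
    IsAlmostInvariant Z U := by
  refine amalgam_induction hsurj (fun i a ha => ?_) fun _ _ => .translation_mul
  refine ((IsCosetFinite.self Z).union ((IsCosetFinite.self Z).preimage_mul_right a)).mono
    fun g hg => ?_
  by_contra! hcon
  exact hg (hU i a ha g (fun hgZ => hcon (.inl hgZ)) fun hgaZ => hcon (.inr hgaZ))

theorem IsAmalgamatedProduct.exists_isAlmostInvariant {G₁ G₂ : Subgroup G}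
    (hG : IsAmalgamatedProduct G₁ G₂ Z) (h₁ : G₁ ≠ Z) (h₂ : G₂ ≠ Z) :
    ∃ U : Set G, IsAlmostInvariant Z U ∧ (∃ g, ∀ n : ℕ, g ^ (n + 1) ∈ U \ Z) ∧
      ∃ g, ∀ n : ℕ, g ^ (n + 1) ∈ Uᶜ \ Z := by
  classical
  obtain ⟨h, hbij⟩ := hG
  obtain ⟨a, ha : a ∈ ![G₁, G₂] 0, haZ⟩ := SetLike.exists_of_lt ((h 0).lt_of_ne h₁.symm)
  obtain ⟨b, hb : b ∈ ![G₁, G₂] 1, hbZ⟩ := SetLike.exists_of_lt ((h 1).lt_of_ne h₂.symm)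
  let d : Fin 2 → G → ℤ := ![fun g => if g ∈ Z then 1 else 0, 0]
  obtain ⟨χ, hχ1, hχ⟩ := exists_glued_cochain hbij d fun i z hz g => by
    fin_cases i <;> simp [d, Subgroup.mul_mem_cancel_right Z hz]
  have hχZ : ∀ i, ∀ a ∈ ![G₁, G₂] i, ∀ g ∉ Z, g * a ∉ Z → χ (g * a) = χ g := by
    intro i a ha g hg hga
    rw [hχ i a ha]
    fin_cases i <;> simp [d, hg, hga]
  have hχa : χ a = -1 := by simpa [d, hχ1, haZ, Z.one_mem] using hχ 0 a ha 1
  have hχb : χ b = 0 := by simpa [d, hχ1] using hχ 1 b hb 1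
  refine ⟨{g | χ g ≠ 0}, isAlmostInvariant_of_forall_mem hbij.2 fun i a ha g hg hga => ?_,
    ⟨a * b, fun n => ⟨?_, ?_⟩⟩, ⟨b * a, fun n => ⟨?_, ?_⟩⟩⟩
  · simp only [Set.mem_ofPred_eq, hχZ i a ha g hg hga]
  · simp [(apply_pow_mul_eq hbij.1 hχZ zero_ne_one ha haZ hb hbZ n).2, hχa]
  · exact (StartsIn.pow_succ zero_ne_one ha haZ hb hbZ n).notMem hbij.1
  · simp [(apply_pow_mul_eq hbij.1 hχZ one_ne_zero hb hbZ ha haZ n).2, hχb]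
  · exact (StartsIn.pow_succ one_ne_zero hb hbZ ha haZ n).notMem hbij.1

end Amalgam

section RealSequences

theorem nonpos_of_midpoint_convex {f : ℕ → ℝ} {n : ℕ} (h0 : f 0 ≤ 0) (hn : f n ≤ 0)
    (hf : ∀ k, k + 2 ≤ n → f (k + 1) ≤ (f k + f (k + 2)) / 2) {k : ℕ} (hk : k ≤ n) : f k ≤ 0 := by
  have slope_le : ∀ k, k + 1 ≤ n → (k + 1 : ℝ) * f k ≤ k * f (k + 1) := by
    intro k
    induction k with
    | zero => intro _; simpa using h0
    | succ k ih =>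
      intro hk
      push_cast
      nlinarith [ih (by omega), hf k (by omega), (by positivity : (0 : ℝ) ≤ k + 1)]
  induction hk using Nat.decreasingInduction with
  | self => exact hn
  | of_succ k hk ih =>
    have hle : (k + 1 : ℝ) * f k ≤ 0 :=
      (slope_le k hk).trans (mul_nonpos_of_nonneg_of_nonpos k.cast_nonneg ih)
    exact nonpos_of_mul_nonpos_right hle k.cast_add_one_pos

theorem nonpos_of_le_mul_average {f : ℤ → ℝ} {r B : ℝ} (hr0 : 0 ≤ r) (hr1 : r < 1)
    (hB : ∀ k, f k ≤ B) (hf : ∀ k, f k ≤ r * ((f (k + 1) + f (k - 1)) / 2)) (k : ℤ) :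
    f k ≤ 0 := by
  have le_pow_mul : ∀ n : ℕ, ∀ k, f k ≤ r ^ n * B := by
    intro n
    induction n with
    | zero => simpa using hB
    | succ n ih =>
      intro k
      refine (hf k).trans ?_
      rw [pow_succ', mul_assoc]
      exact mul_le_mul_of_nonneg_left (by linarith [ih (k + 1), ih (k - 1)]) hr0
  have hlim := (tendsto_pow_atTop_nhds_zero_of_lt_one hr0 hr1).mul_const B
  rw [zero_mul] at hlim
  exact ge_of_tendsto' hlim fun n => le_pow_mul n k

-- The quadratic `(l / 2) * (q * k ^ 2 + 2 / q)` is a supersolution of the same recursion.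
theorem le_div_of_le_resolvent {f : ℤ → ℝ} {q l A : ℝ} (hq0 : 0 < q) (hq1 : q ≤ 1) (hl : 0 ≤ l)
    (hA : ∀ k : ℤ, f k ≤ A + l * |(k : ℝ)|)
    (hf : ∀ k : ℤ, f k ≤
      q ^ 2 * (l * |(k : ℝ)|) + (1 - q ^ 2) * ((f (k + 1) + f (k - 1)) / 2)) :
    f 0 ≤ l / q := by
  have hlin (k : ℤ) : 2 * (q * |(k : ℝ)|) ≤ q ^ 2 * (k : ℝ) ^ 2 + 1 := by
    nlinarith [sq_nonneg (q * |(k : ℝ)| - 1), sq_abs (k : ℝ)]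
  have hle := nonpos_of_le_mul_average (f := fun k => f k - l / 2 * (q * (k : ℝ) ^ 2) - l / q)
    (r := 1 - q ^ 2) (B := A) (by nlinarith) (by nlinarith) (fun k => ?_) (fun k => ?_) 0
  · simpa using hle
  · have hk : l * |(k : ℝ)| ≤ l / 2 * (q * (k : ℝ) ^ 2) + l / q := by
      field_simp
      nlinarith [mul_le_mul_of_nonneg_left (hlin k) hl]
    linarith [hA k]
  · have hk : q ^ 2 * (l * |(k : ℝ)|) ≤
        q ^ 2 * (l / 2 * (q * (k : ℝ) ^ 2) + l / q) - (1 - q ^ 2) * (l / 2 * q) := by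
      have hquad : q ^ 2 * (l / q) = q * l := by field_simp
      nlinarith [mul_le_mul_of_nonneg_left (hlin k) (mul_nonneg hq0.le hl),
        mul_nonneg (mul_nonneg hl hq0.le) (sq_nonneg q)]
    push_cast
    linarith [hf k]

end RealSequences

namespace IsGeometricAction

variable {G X : Type*} [Group G] [MetricSpace X] [MulAction G X]

theorem isIsometricSMul (hGX : IsGeometricAction G X) : IsIsometricSMul G X := ⟨hGX.isometric⟩

theorem exists_dist_smul_le (hGX : IsGeometricAction G X) (o : X) :
    ∃ D : ℝ, ∀ x : X, ∃ g : G, dist x (g • o) ≤ D := by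
  have := hGX.isIsometricSMul
  have := hGX.cocompact
  let q : X → Quotient (MulAction.orbitRel G X) := Quotient.mk _
  have hq : IsOpenMap q := isOpenMap_quotient_mk'_mul
  have hcover : Set.univ ⊆ ⋃ n : ℕ, q '' Metric.ball o n := by
    intro a _
    obtain ⟨x, rfl⟩ := Quotient.exists_rep a
    obtain ⟨n, hn⟩ := exists_nat_gt (dist x o)
    exact Set.mem_iUnion.2 ⟨n, x, hn, rfl⟩
  have hmono : Monotone fun n : ℕ => q '' Metric.ball o n := fun m n hmn =>
    Set.image_mono (Metric.ball_subset_ball (Nat.cast_le.2 hmn))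
  obtain ⟨n, hn⟩ := isCompact_univ.elim_directed_cover _ (fun _ => hq _ Metric.isOpen_ball) hcover
    hmono.directed_le
  refine ⟨n, fun x => ?_⟩
  obtain ⟨y, hy, hyx⟩ := hn (Set.mem_univ (q x))
  obtain ⟨g, rfl⟩ : y ∈ MulAction.orbit G x := Quotient.exact hyx
  refine ⟨g⁻¹, ?_⟩
  rw [← dist_smul g, smul_inv_smul]
  exact hy.le

theorem finite_dist_smul_le [ProperSpace X] (hGX : IsGeometricAction G X) (o : X) (R : ℝ) :
    {g : G | dist o (g • o) ≤ R}.Finite := by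
  refine (hGX.proper _ (isCompact_closedBall o |R|)).subset fun g hg => ?_
  exact ⟨g • o, ⟨o, Metric.mem_closedBall_self (abs_nonneg R), rfl⟩,
    Metric.mem_closedBall'.2 (hg.trans (le_abs_self R))⟩

theorem isOfFinOrder_of_smul_eq [ProperSpace X] (hGX : IsGeometricAction G X) {g : G} {x : X}
    (hg : g • x = x) : IsOfFinOrder g := by
  refine finite_zpowers.1 ((hGX.finite_dist_smul_le x 0).subset fun h hh => ?_)
  have hhx : h • x = x :=
    Subgroup.zpowers_le.2 (MulAction.mem_stabilizer_iff.2 hg : g ∈ MulAction.stabilizer G x) hh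
  simp [hhx]

end IsGeometricAction

theorem IsAlmostInvariant.isCosetFinite_dist_le {G X : Type*} [Group G] [MetricSpace X]
    [MulAction G X] [IsIsometricSMul G X] {H : Subgroup G} {U : Set G} (hU : IsAlmostInvariant H U)
    {o : X} {R : ℝ} (hfin : {k : G | dist o (k • o) ≤ R}.Finite) :
    IsCosetFinite H {g | g ∈ U ∧ ∃ g' ∉ U, dist (g • o) (g' • o) ≤ R} := by
  refine (IsCosetFinite.biUnion hfin hU).mono ?_
  rintro g ⟨hg, g', hg', hdist⟩
  refine Set.mem_biUnion (x := g⁻¹ * g') ?_ ?_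
  · rwa [Set.mem_ofPred_eq, ← dist_smul g, mul_smul, smul_inv_smul]
  · simp [hg, hg']

theorem not_isOfFinOrder_of_forall_pow_notMem {G : Type*} [Group G] {H : Subgroup G} {g : G}
    (hg : ∀ n : ℕ, g ^ (n + 1) ∉ H) : ¬ IsOfFinOrder g := by
  rw [isOfFinOrder_iff_pow_eq_one]
  rintro ⟨n, hn, hgn⟩
  exact hg (n - 1) (by rw [Nat.sub_add_cancel hn, hgn]; exact one_mem H)

namespace Bicombing

section Segments

variable {X : Type*} [MetricSpace X] (σ : Bicombing X)

/-- The `σ`-geodesic from `x` to `y`, parametrized by the real numbers, constant outside `[0,1]`. -/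
noncomputable def seg (x y : X) (t : ℝ) : X := σ x y (Set.projIcc 0 1 zero_le_one t)

theorem seg_of_mem {t : ℝ} (x y : X) (ht : t ∈ Set.Icc (0 : ℝ) 1) :
    σ.seg x y t = σ x y ⟨t, ht⟩ := by
  rw [seg, Set.projIcc_of_mem _ ht]

@[simp] theorem seg_zero (x y : X) : σ.seg x y 0 = x := by
  rw [seg, Set.projIcc_left]
  exact σ.map_zero x y

@[simp] theorem seg_one (x y : X) : σ.seg x y 1 = y := by
  rw [seg, Set.projIcc_right]
  exact σ.map_one x y

theorem continuous_seg {Y : Type*} [TopologicalSpace Y] {f g : Y → X} {h : Y → ℝ}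
    (hf : Continuous f) (hg : Continuous g) (hh : Continuous h) :
    Continuous fun p => σ.seg (f p) (g p) (h p) :=
  σ.continuous_toFun.comp (hf.prodMk (hg.prodMk ((continuous_projIcc (h := zero_le_one)).comp hh)))

theorem dist_seg_seg (x y : X) {s t : ℝ} (hs : s ∈ Set.Icc (0 : ℝ) 1)
    (ht : t ∈ Set.Icc (0 : ℝ) 1) :
    dist (σ.seg x y s) (σ.seg x y t) = |s - t| * dist x y := by
  rw [σ.seg_of_mem x y hs, σ.seg_of_mem x y ht]
  exact σ.dist_map _ _ _ _

theorem dist_left_seg (x y : X) {t : ℝ} (ht : t ∈ Set.Icc (0 : ℝ) 1) :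
    dist x (σ.seg x y t) = t * dist x y := by
  simpa [abs_of_nonneg ht.1] using σ.dist_seg_seg x y (s := 0) (by simp) ht

@[simp] theorem seg_self (x : X) (t : ℝ) : σ.seg x x t = x := by
  simpa [seg, σ.map_zero] using σ.dist_map x x (Set.projIcc 0 1 zero_le_one t) 0

variable {σ}

theorem IsConical.dist_seg_le (hσ : σ.IsConical) (x y x' y' : X) {t : ℝ}
    (ht : t ∈ Set.Icc (0 : ℝ) 1) :
    dist (σ.seg x y t) (σ.seg x' y' t) ≤ (1 - t) * dist x x' + t * dist y y' := by
  rw [σ.seg_of_mem x y ht, σ.seg_of_mem x' y' ht]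
  exact hσ _ _ _ _ _

theorem IsReversible.seg_symm (hσ : σ.IsReversible) (x y : X) {t : ℝ}
    (ht : t ∈ Set.Icc (0 : ℝ) 1) : σ.seg x y t = σ.seg y x (1 - t) := by
  rw [σ.seg_of_mem x y ht, σ.seg_of_mem y x (Set.Icc.mem_iff_one_sub_mem.1 ht), hσ]
  rfl

theorem IsEquivariant.smul_seg {G : Type*} [Group G] [MulAction G X] (hσ : σ.IsEquivariant G)
    (g : G) (x y : X) (t : ℝ) : g • σ.seg x y t = σ.seg (g • x) (g • y) t :=
  hσ g x y _

theorem eq_seg_of_mem_range {x y p : X} (hp : p ∈ Set.range (σ x y)) {t : ℝ}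
    (ht : t ∈ Set.Icc (0 : ℝ) 1) (hdist : dist x p = t * dist x y) : p = σ.seg x y t := by
  obtain ⟨u, rfl⟩ := hp
  rw [← σ.seg_of_mem x y u.2, σ.dist_left_seg x y u.2] at hdist
  rw [← σ.seg_of_mem x y u.2, ← dist_eq_zero, σ.dist_seg_seg x y u.2 ht]
  rcases mul_eq_mul_right_iff.1 hdist with hut | hxy
  · simp [hut]
  · simp [hxy]

theorem IsConsistent.seg_seg (hσ : σ.IsConsistent) (x y : X) {a b t : ℝ}
    (ha : 0 ≤ a) (hab : a ≤ b) (hb : b ≤ 1) (ht : t ∈ Set.Icc (0 : ℝ) 1) :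
    σ.seg (σ.seg x y a) (σ.seg x y b) t = σ.seg x y (a + t * (b - a)) := by
  rcases hab.eq_or_lt with rfl | hlt
  · simp
  have hta : 0 ≤ t * (b - a) := mul_nonneg ht.1 (by linarith)
  have htb : t * (b - a) ≤ b - a := mul_le_of_le_one_left (by linarith) ht.2
  have ha' : a ∈ Set.Icc (0 : ℝ) 1 := ⟨ha, by linarith⟩
  have hb' : b ∈ Set.Icc (0 : ℝ) 1 := ⟨by linarith, hb⟩
  have hw : a + t * (b - a) ∈ Set.Icc (0 : ℝ) 1 := ⟨by linarith, by linarith⟩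
  refine (eq_seg_of_mem_range ?_ ht ?_).symm
  · rw [σ.seg_of_mem x y ha', σ.seg_of_mem x y hb', σ.seg_of_mem x y hw, hσ x y _ _ hlt]
    exact Set.mem_image_of_mem _
      ⟨Subtype.coe_le_coe.1 (by simpa using hta), Subtype.coe_le_coe.1 (by simp; linarith)⟩
  · rw [σ.dist_seg_seg x y ha' hw, σ.dist_seg_seg x y ha' hb', ← mul_assoc, abs_sub_comm,
      abs_sub_comm a b, add_sub_cancel_left, abs_mul, abs_of_nonneg ht.1]

end Segments

section Rays

open Filter Topology

variable {X : Type*} [MetricSpace X] {σ : Bicombing X}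

theorem div_mem_Icc_of_le {s t : ℝ≥0} (hst : s ≤ t) : (s / t : ℝ) ∈ Set.Icc (0 : ℝ) 1 :=
  ⟨by positivity, div_le_one_of_le₀ (by exact_mod_cast hst) t.2⟩

namespace Ray

theorem dist_eq (ξ : σ.Ray) (s t : ℝ≥0) : dist (ξ s) (ξ t) = |(s : ℝ) - t| := by
  rw [ξ.isometry.dist_eq, NNReal.dist_eq]

@[simp] theorem dist_zero_left (ξ : σ.Ray) (t : ℝ≥0) : dist (ξ 0) (ξ t) = t := by
  simp [dist_eq]

theorem seg_zero_eq (ξ : σ.Ray) {s t : ℝ≥0} (hst : s ≤ t) : σ.seg (ξ 0) (ξ t) (s / t) = ξ s := by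
  refine (eq_seg_of_mem_range ?_ (div_mem_Icc_of_le hst) ?_).symm
  · rw [ξ.range_eq]
    exact Set.mem_image_of_mem _ ⟨zero_le, hst⟩
  · rw [dist_zero_left, dist_zero_left, div_mul_cancel_of_imp]
    intro ht
    exact_mod_cast le_antisymm (hst.trans_eq (by exact_mod_cast ht)) zero_le

/-- The ray given by an isometric embedding whose initial segments are, with their
parametrization, `σ`-geodesics. -/
def ofSegEq (f : ℝ≥0 → X) (hf : Isometry f)
    (hseg : ∀ s t : ℝ≥0, s ≤ t → σ.seg (f 0) (f t) (s / t) = f s) : σ.Ray where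
  toFun := f
  isometry := hf
  range_eq t := by
    apply Set.Subset.antisymm
    · rintro _ ⟨u, rfl⟩
      rcases eq_or_ne t 0 with rfl | ht
      · exact ⟨0, by simp, by rw [← σ.seg_of_mem _ _ u.2, seg_self]⟩
      have hu : unitInterval.toNNReal u * t ≤ t := mul_le_of_le_one_left zero_le u.2.2
      refine ⟨unitInterval.toNNReal u * t, ⟨zero_le, hu⟩, ?_⟩
      rw [← hseg _ _ hu, NNReal.coe_mul, mul_div_cancel_right₀ _ (by exact_mod_cast ht)]
      exact σ.seg_of_mem _ _ u.2
    · rintro _ ⟨s, ⟨-, hst⟩, rfl⟩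
      rw [← hseg s t hst]
      exact Set.mem_range_self _

theorem dist_le (hσ : σ.IsConical) (ξ η : σ.Ray) {s t : ℝ≥0} (hst : s ≤ t) :
    dist (ξ s) (η s) ≤ (1 - s / t) * dist (ξ 0) (η 0) + s / t * dist (ξ t) (η t) := by
  rw [← ξ.seg_zero_eq hst, ← η.seg_zero_eq hst]
  exact hσ.dist_seg_le _ _ _ _ (div_mem_Icc_of_le hst)

theorem dist_le_of_frequently (hσ : σ.IsConical) (ξ η : σ.Ray) {C : ℝ}
    (hC : dist (ξ 0) (η 0) ≤ C) (h : ∃ᶠ t in atTop, dist (ξ t) (η t) ≤ C) (s : ℝ≥0) :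
    dist (ξ s) (η s) ≤ C := by
  obtain ⟨t, hst, ht⟩ := h.forall_exists_of_atTop s
  obtain ⟨hu0, hu1⟩ := div_mem_Icc_of_le hst
  nlinarith [ξ.dist_le hσ η hst]

theorem eq_of_asymptotic (hσ : σ.IsConical) (ξ η : σ.Ray) (h0 : ξ 0 = η 0)
    (h : ξ.toBoundary = η.toBoundary) (s : ℝ≥0) : ξ s = η s := by
  obtain ⟨C, hC⟩ : ∃ C : ℝ, ∀ t : ℝ≥0, dist (ξ t) (η t) ≤ C := Quotient.exact h
  have hlim : Tendsto (fun t : ℝ≥0 => (s / t * C : ℝ)) atTop (𝓝 0) := by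
    simpa using ((NNReal.tendsto_coe_atTop.2 tendsto_id).const_div_atTop (s : ℝ)).mul_const C
  refine dist_le_zero.1 (ge_of_tendsto hlim ?_)
  filter_upwards [eventually_ge_atTop s] with t hst
  calc dist (ξ s) (η s) ≤ s / t * dist (ξ t) (η t) := by simpa [h0] using ξ.dist_le hσ η hst
    _ ≤ s / t * C := mul_le_mul_of_nonneg_left (hC t) (by positivity)

/-- The point at distance about `s` from `o` on the `σ`-geodesic from `o` to `ξ T`. As `T → ∞`,
these geodesics converge to the ray from `o` asymptotic to `ξ`. -/
noncomputable def chord (ξ : σ.Ray) (o : X) (T s : ℝ≥0) : X := σ.seg o (ξ T) (s / T)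

variable {ξ : σ.Ray} {o : X} {s t T T' : ℝ≥0}

@[simp] theorem chord_zero : ξ.chord o T 0 = o := by
  simp [chord]

theorem dist_chord_le (hσ : σ.IsConical) (hsT : s ≤ T) :
    dist (ξ.chord o T s) (ξ s) ≤ dist o (ξ 0) := calc
  dist (ξ.chord o T s) (ξ s) = dist (ξ.chord o T s) (σ.seg (ξ 0) (ξ T) (s / T)) := by
    rw [ξ.seg_zero_eq hsT]
  _ ≤ (1 - s / T) * dist o (ξ 0) := by
    simpa [chord] using hσ.dist_seg_le o (ξ T) (ξ 0) (ξ T) (div_mem_Icc_of_le hsT)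
  _ ≤ dist o (ξ 0) :=
    mul_le_of_le_one_left dist_nonneg (sub_le_self _ (by positivity))

theorem seg_chord (hσ : σ.IsConsistent) (hst : s ≤ t) (htT : t ≤ T) :
    σ.seg o (ξ.chord o T t) (s / t) = ξ.chord o T s := by
  rcases eq_or_ne t 0 with rfl | ht
  · simp [nonpos_iff_eq_zero.1 hst]
  have ht' : (t : ℝ) ≠ 0 := by exact_mod_cast ht
  have hseg := hσ.seg_seg o (ξ T) le_rfl (div_mem_Icc_of_le htT).1 (div_mem_Icc_of_le htT).2
    (div_mem_Icc_of_le hst)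
  rwa [seg_zero, zero_add, sub_zero, div_mul_div_cancel₀ ht'] at hseg

theorem dist_chord_chord_le (hσ : σ.IsCCC) (hsT : s ≤ T) (hT : T ≤ T') :
    dist (ξ.chord o T s) (ξ.chord o T' s) ≤ s / T * dist o (ξ 0) := calc
  dist (ξ.chord o T s) (ξ.chord o T' s)
      = dist (σ.seg o (ξ T) (s / T)) (σ.seg o (ξ.chord o T' T) (s / T)) := by
    rw [seg_chord hσ.1 hsT hT, chord]
  _ ≤ s / T * dist (ξ T) (ξ.chord o T' T) := by
    simpa using hσ.2.dist_seg_le o (ξ T) o (ξ.chord o T' T) (div_mem_Icc_of_le hsT)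
  _ ≤ s / T * dist o (ξ 0) := by
    rw [dist_comm (ξ T)]
    exact mul_le_mul_of_nonneg_left (dist_chord_le hσ.2 hT) (by positivity)

theorem tendsto_dist_div (ξ : σ.Ray) (o : X) :
    Tendsto (fun T : ℝ≥0 => dist o (ξ T) / T) atTop (𝓝 1) := by
  rw [tendsto_iff_dist_tendsto_zero]
  refine squeeze_zero' (.of_forall fun T => dist_nonneg) ?_
    ((NNReal.tendsto_coe_atTop.2 tendsto_id).const_div_atTop (dist o (ξ 0)))
  filter_upwards [eventually_gt_atTop 0] with T hT
  have hT' : (0 : ℝ) < T := by exact_mod_cast hT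
  rw [Real.dist_eq, div_sub_one hT'.ne', abs_div, abs_of_pos hT']
  exact div_le_div_of_nonneg_right (by simpa using abs_dist_sub_le o (ξ 0) (ξ T)) hT'.le

theorem tendsto_dist_chord (ξ : σ.Ray) (o : X) (s t : ℝ≥0) :
    Tendsto (fun T => dist (ξ.chord o T s) (ξ.chord o T t)) atTop (𝓝 |(s : ℝ) - t|) := by
  have hlim := (ξ.tendsto_dist_div o).const_mul |(s : ℝ) - t|
  rw [mul_one] at hlim
  refine hlim.congr' ?_
  filter_upwards [eventually_ge_atTop s, eventually_ge_atTop t] with T hsT htT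
  rw [chord, chord, σ.dist_seg_seg _ _ (div_mem_Icc_of_le hsT) (div_mem_Icc_of_le htT), ← sub_div,
    abs_div, NNReal.abs_eq, div_mul_eq_mul_div, mul_div_assoc]

theorem exists_tendsto_chord [CompleteSpace X] (hσ : σ.IsCCC) (ξ : σ.Ray) (o : X) (s : ℝ≥0) :
    ∃ x, Tendsto (fun T => ξ.chord o T s) atTop (𝓝 x) := by
  refine cauchySeq_tendsto_of_complete (Metric.cauchySeq_iff'.2 fun ε hε => ?_)
  have hlim : Tendsto (fun T : ℝ≥0 => (s / T * dist o (ξ 0) : ℝ)) atTop (𝓝 0) := by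
    simpa using
      ((NNReal.tendsto_coe_atTop.2 tendsto_id).const_div_atTop (s : ℝ)).mul_const (dist o (ξ 0))
  obtain ⟨T, hsT, hT⟩ :=
    ((eventually_ge_atTop s).and (hlim.eventually (gt_mem_nhds hε))).exists
  refine ⟨T, fun T' hT' => ?_⟩
  rw [dist_comm]
  exact (dist_chord_chord_le hσ hsT hT').trans_lt hT

theorem exists_asymptotic [CompleteSpace X] (hσ : σ.IsCCC) (ξ : σ.Ray) (o : X) :
    ∃ η : σ.Ray, η 0 = o ∧ ∀ t : ℝ≥0, dist (η t) (ξ t) ≤ dist o (ξ 0) := by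
  choose f hf using exists_tendsto_chord hσ ξ o
  have hf0 : f 0 = o := tendsto_nhds_unique (hf 0) (by simp)
  have hiso : Isometry f := Isometry.of_dist_eq fun s t =>
    (tendsto_nhds_unique ((hf s).dist (hf t)) (ξ.tendsto_dist_chord o s t)).trans
      (NNReal.dist_eq s t).symm
  refine ⟨ofSegEq f hiso fun s t hst => ?_, hf0, fun t => ?_⟩
  · have hseg : Tendsto (fun T => σ.seg o (ξ.chord o T t) (s / t)) atTop
        (𝓝 (σ.seg o (f t) (s / t))) :=
      ((σ.continuous_seg continuous_const continuous_id continuous_const).tendsto (f t)).comp (hf t)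
    rw [hf0]
    refine tendsto_nhds_unique hseg ((hf s).congr' ?_)
    filter_upwards [eventually_ge_atTop t] with T htT
    exact (seg_chord hσ.1 hst htT).symm
  · refine le_of_tendsto ((hf t).dist tendsto_const_nhds) ?_
    filter_upwards [eventually_ge_atTop t] with T htT
    exact dist_chord_le hσ.2 htT

end Ray

end Rays

section Lines

open Filter Metric

variable {X : Type*} [MetricSpace X] {σ : Bicombing X} {c : ℝ → X}

/-- A `σ`-line: an isometric embedding of the real line whose segments are, with their
parametrization, `σ`-geodesics in both directions. -/
structure IsLine (σ : Bicombing X) (c : ℝ → X) : Prop where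
  isometry : Isometry c
  seg_eq : ∀ a b : ℝ, ∀ u ∈ Set.Icc (0 : ℝ) 1, σ.seg (c a) (c b) u = c (a + u * (b - a))

namespace IsLine

theorem dist_eq (hc : σ.IsLine c) (s t : ℝ) : dist (c s) (c t) = |s - t| := by
  rw [hc.isometry.dist_eq, Real.dist_eq]

theorem neg (hc : σ.IsLine c) : σ.IsLine fun t => c (-t) where
  isometry := hc.isometry.comp (IsometryEquiv.neg ℝ).isometry
  seg_eq a b u hu := by
    rw [hc.seg_eq _ _ u hu]
    ring_nf

/-- The positive half of a `σ`-line. -/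
def ray (hc : σ.IsLine c) : σ.Ray :=
  .ofSegEq (fun t => c t) (hc.isometry.comp isometry_subtype_coe) fun s t hst => by
    rw [hc.seg_eq _ _ _ (div_mem_Icc_of_le hst), NNReal.coe_zero, zero_add, sub_zero,
      div_mul_cancel_of_imp]
    intro ht
    exact le_antisymm (hst.trans_eq (by exact_mod_cast ht)) s.2

@[simp] theorem ray_apply (hc : σ.IsLine c) (t : ℝ≥0) : hc.ray t = c t := rfl

theorem toBoundary_ray_ne_neg (hc : σ.IsLine c) :
    hc.ray.toBoundary ≠ hc.neg.ray.toBoundary := by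
  intro h
  obtain ⟨C, hC⟩ : ∃ C : ℝ, ∀ t : ℝ≥0, dist (hc.ray t) (hc.neg.ray t) ≤ C := Quotient.exact h
  have hdist := hC (C.toNNReal + 1)
  rw [ray_apply, ray_apply, hc.dist_eq, sub_neg_eq_add, abs_of_nonneg (by positivity),
    NNReal.coe_add, NNReal.coe_one] at hdist
  linarith [C.le_coe_toNNReal, C.toNNReal.2]

theorem infDist_seg_le (hσ : σ.IsConical) (hc : σ.IsLine c) (x y : X) {u : ℝ}
    (hu : u ∈ Set.Icc (0 : ℝ) 1) :
    infDist (σ.seg x y u) (Set.range c) ≤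
      (1 - u) * infDist x (Set.range c) + u * infDist y (Set.range c) := by
  refine le_of_forall_pos_le_add fun ε hε => ?_
  have hnear (z : X) : ∃ a, dist z (c a) < infDist z (Set.range c) + ε := by
    simpa using (infDist_lt_iff (Set.range_nonempty c)).1 (lt_add_of_pos_right (infDist z _) hε)
  obtain ⟨a, ha⟩ := hnear x
  obtain ⟨b, hb⟩ := hnear y
  calc infDist (σ.seg x y u) (Set.range c)
      ≤ dist (σ.seg x y u) (σ.seg (c a) (c b) u) :=
        infDist_le_dist_of_mem ⟨_, (hc.seg_eq a b u hu).symm⟩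
    _ ≤ (1 - u) * dist x (c a) + u * dist y (c b) := hσ.dist_seg_le _ _ _ _ hu
    _ ≤ (1 - u) * (infDist x (Set.range c) + ε) + u * (infDist y (Set.range c) + ε) :=
        add_le_add (mul_le_mul_of_nonneg_left ha.le (sub_nonneg.2 hu.2))
          (mul_le_mul_of_nonneg_left hb.le hu.1)
    _ = (1 - u) * infDist x (Set.range c) + u * infDist y (Set.range c) + ε := by ring

theorem isUpperSet_lt_infDist (hσ : σ.IsConical) (hc : σ.IsLine c) (η : σ.Ray) {M : ℝ}
    (h0 : infDist (η 0) (Set.range c) ≤ M) :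
    IsUpperSet {t : ℝ≥0 | M < infDist (η t) (Set.range c)} := by
  intro s t hst hs
  by_contra ht
  obtain ⟨hu0, hu1⟩ := div_mem_Icc_of_le hst
  have hle := hc.infDist_seg_le hσ (η 0) (η t) ⟨hu0, hu1⟩
  rw [η.seg_zero_eq hst] at hle
  refine (hs.trans_le hle).not_ge ?_
  simp only [Set.mem_ofPred_eq, not_lt] at ht
  nlinarith

theorem toBoundary_eq_of_frequently (hσ : σ.IsConical) (hc : σ.IsLine c) (η : σ.Ray) {R : ℝ}
    (h : ∃ᶠ t in atTop, ∃ s : ℝ, 0 ≤ s ∧ dist (η t) (c s) ≤ R) :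
    η.toBoundary = hc.ray.toBoundary := by
  have hR : 0 ≤ R := by
    obtain ⟨t, s, -, hts⟩ := h.exists
    exact dist_nonneg.trans hts
  refine Quotient.sound ⟨2 * R + dist (η 0) (c 0), η.dist_le_of_frequently hσ hc.ray ?_ ?_⟩
  · simpa using hR
  refine h.mono fun t ⟨s, hs, hts⟩ => ?_
  have hst : |s - t| ≤ R + dist (η 0) (c 0) := by
    have hηt := η.dist_zero_left t
    have hcs : dist (c 0) (c s) = s := by simp [hc.dist_eq, abs_of_nonneg hs]
    rw [abs_le]
    constructor
    · linarith [dist_triangle4_right (η 0) (η t) (c 0) (c s)]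
    · linarith [dist_triangle4 (c 0) (η 0) (η t) (c s), dist_comm (c 0) (η 0)]
  calc dist (η t) (hc.ray t) ≤ dist (η t) (c s) + dist (c s) (c t) := dist_triangle _ _ _
    _ ≤ 2 * R + dist (η 0) (c 0) := by rw [hc.dist_eq]; linarith

theorem toBoundary_eq_or_eq (hσ : σ.IsConical) (hc : σ.IsLine c) (η : σ.Ray) {R : ℝ}
    (hR : ∀ t, infDist (η t) (Set.range c) ≤ R) :
    η.toBoundary = hc.ray.toBoundary ∨ η.toBoundary = hc.neg.ray.toBoundary := by
  have hnear (t : ℝ≥0) : ∃ s, dist (η t) (c s) < R + 1 := by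
    simpa using (infDist_lt_iff (Set.range_nonempty c)).1 ((hR t).trans_lt (lt_add_one R))
  have hside : ∃ᶠ t in atTop, (∃ s : ℝ, 0 ≤ s ∧ dist (η t) (c s) ≤ R + 1) ∨
      ∃ s : ℝ, 0 ≤ s ∧ dist (η t) (c (-s)) ≤ R + 1 := by
    refine .of_forall fun t => ?_
    obtain ⟨s, hs⟩ := hnear t
    rcases le_total 0 s with h0 | h0
    · exact .inl ⟨s, h0, hs.le⟩
    · exact .inr ⟨-s, neg_nonneg.2 h0, by simpa using hs.le⟩
  exact (frequently_or_distrib.1 hside).imp (hc.toBoundary_eq_of_frequently hσ η)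
    (hc.neg.toBoundary_eq_of_frequently hσ η)

end IsLine

end Lines

section Separation

open Metric Topology

variable {X : Type*} [MetricSpace X] {σ : Bicombing X} {c : ℝ → X}

/-- The boundary points whose representative issuing from `o` meets `W`. -/
def shadow (σ : Bicombing X) (o : X) (W : Set X) : Set σ.Boundary :=
  {b | ∃ η : σ.Ray, η 0 = o ∧ η.toBoundary = b ∧ ∃ t, η t ∈ W}

theorem isOpen_shadow {W : Set X} (hW : IsOpen W) (o : X) :
    IsOpen[σ.boundaryTopology o] (σ.shadow o W) := by
  let := σ.boundaryTopology o
  rw [isOpen_iff_forall_mem_open]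
  rintro _ ⟨ξ, h0, rfl, t, ht⟩
  obtain ⟨ε, hε, hball⟩ := Metric.isOpen_iff.1 hW _ ht
  refine ⟨σ.basicNhd ξ t ε, ?_, ?_, ξ, rfl, rfl, by simpa using hε⟩
  · rintro _ ⟨η, hη0, rfl, hη⟩
    exact ⟨η, hη0.trans h0, rfl, t, hball hη⟩
  · exact TopologicalSpace.isOpen_generateFrom_of_mem ⟨ξ, t, ε, h0, hε, rfl⟩

/-- A ray is deep in `S` if `S` contains balls of any given radius centred on the ray. Rays at
bounded distance from each other are deep in the same sets. -/
def Ray.IsDeep (ξ : σ.Ray) (S : Set X) : Prop := ∀ C : ℝ, ∃ t, closedBall (ξ t) C ⊆ S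

namespace Ray.IsDeep

variable {ξ η : σ.Ray} {S A L : Set X}

theorem of_dist_le (hξ : ξ.IsDeep S) {D : ℝ} (hD : ∀ t, dist (η t) (ξ t) ≤ D) : η.IsDeep S := by
  intro C
  obtain ⟨t, ht⟩ := hξ (C + D)
  exact ⟨t, (closedBall_subset_closedBall' (by linarith [hD t])).trans ht⟩

theorem toBoundary_ne (hξ : ξ.IsDeep S) (hη : ∀ t, η t ∉ S) : ξ.toBoundary ≠ η.toBoundary := by
  intro h
  obtain ⟨C, hC⟩ : ∃ C : ℝ, ∀ t : ℝ≥0, dist (ξ t) (η t) ≤ C := Quotient.exact h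
  obtain ⟨t, ht⟩ := hξ C
  exact hη t (ht (mem_closedBall'.2 (hC t)))

theorem exists_lt_infDist (hξ : ξ.IsDeep (A \ L)) (hL : L.Nonempty) (M : ℝ) :
    ∃ t, ξ t ∈ A ∧ M < infDist (ξ t) L := by
  obtain ⟨t, ht⟩ := hξ (|M| + 1)
  refine ⟨t, (ht (mem_closedBall_self (by positivity))).1, ?_⟩
  calc M < |M| + 1 := by linarith [le_abs_self M]
    _ ≤ infDist (ξ t) L := by
      refine (le_infDist hL).2 fun y hy => ?_
      by_contra! hlt
      exact (ht (mem_closedBall'.2 hlt.le)).2 hy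

end Ray.IsDeep

namespace IsLine

variable {A B : Set X} {M : ℝ} {o : X}

theorem disjoint_shadow (hσ : σ.IsConical) (hc : σ.IsLine c) (hA : IsOpen A) (hB : IsOpen B)
    (hAB : A ∪ B = Set.univ) (hM : ∀ x ∈ A ∩ B, infDist x (Set.range c) ≤ M)
    (ho : infDist o (Set.range c) ≤ M) :
    Disjoint (σ.shadow o (A ∩ {x | M < infDist x (Set.range c)}))
      (σ.shadow o (B ∩ {x | M < infDist x (Set.range c)})) := by
  set V := {x | M < infDist x (Set.range c)}
  have hV : IsOpen V := isOpen_lt continuous_const (continuous_infDist_pt _)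
  have hdisj : Disjoint (A ∩ V) (B ∩ V) :=
    Set.disjoint_left.2 fun x hxA hxB => (hM x ⟨hxA.1, hxB.1⟩).not_gt hxA.2
  refine Set.disjoint_left.2 ?_
  rintro _ ⟨ξ, hξ0, rfl, t, ht⟩ ⟨η, hη0, hηξ, t', ht'⟩
  rw [η.eq_of_asymptotic hσ ξ (hη0.trans hξ0.symm) hηξ] at ht'
  have hconn : IsPreconnected (ξ.toFun '' {t | ξ t ∈ V}) :=
    (hc.isUpperSet_lt_infDist hσ ξ (hξ0 ▸ ho)).ordConnected.isPreconnected.image _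
      ξ.isometry.continuous.continuousOn
  have hcover : ξ.toFun '' {t | ξ t ∈ V} ⊆ A ∩ V ∪ B ∩ V := by
    rw [← Set.union_inter_distrib_right, hAB, Set.univ_inter]
    exact Set.image_subset_iff.2 fun t ht => ht
  have hsub := hconn.subset_left_of_subset_union (hA.inter hV) (hB.inter hV) hdisj hcover
    ⟨ξ t, ⟨t, ht.2, rfl⟩, ht⟩
  exact Set.disjoint_left.1 hdisj (hsub ⟨t', ht'.2, rfl⟩) ht'

theorem compl_ends_subset [CompleteSpace X] (hσ : σ.IsCCC) (hc : σ.IsLine c)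
    (hAB : A ∪ B = Set.univ) (M : ℝ) (o : X) :
    ({hc.ray.toBoundary, hc.neg.ray.toBoundary}ᶜ : Set σ.Boundary) ⊆
      σ.shadow o (A ∩ {x | M < infDist x (Set.range c)}) ∪
        σ.shadow o (B ∩ {x | M < infDist x (Set.range c)}) := by
  intro b hb
  obtain ⟨ξ, rfl⟩ : ∃ ξ : σ.Ray, ξ.toBoundary = b := Quotient.exists_rep b
  obtain ⟨η, hη0, hη⟩ := ξ.exists_asymptotic hσ o
  have hηξ : η.toBoundary = ξ.toBoundary := Quotient.sound ⟨_, hη⟩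
  have hfar : ∃ t, M < infDist (η t) (Set.range c) := by
    by_contra! hnear
    exact hb (hηξ ▸ hc.toBoundary_eq_or_eq hσ.2 η hnear)
  obtain ⟨t, ht⟩ := hfar
  rcases hAB.ge (Set.mem_univ (η t)) with htA | htB
  · exact .inl ⟨η, hη0, hηξ, t, htA, ht⟩
  · exact .inr ⟨η, hη0, hηξ, t, htB, ht⟩

theorem nonempty_shadow [CompleteSpace X] (hσ : σ.IsCCC) (hc : σ.IsLine c) {ξ : σ.Ray}
    (hξ : ξ.IsDeep (A \ Set.range c)) (M : ℝ) (o : X) :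
    ({hc.ray.toBoundary, hc.neg.ray.toBoundary}ᶜ ∩
      σ.shadow o (A ∩ {x | M < infDist x (Set.range c)})).Nonempty := by
  obtain ⟨η, hη0, hη⟩ := ξ.exists_asymptotic hσ o
  have hdeep : η.IsDeep (A \ Set.range c) := hξ.of_dist_le hη
  refine ⟨η.toBoundary, ?_, η, hη0, rfl, hdeep.exists_lt_infDist (Set.range_nonempty c) M⟩
  rintro (h | h)
  · exact hdeep.toBoundary_ne (fun t ht => ht.2 ⟨t, rfl⟩) h
  · exact hdeep.toBoundary_ne (fun t ht => ht.2 ⟨-t, rfl⟩) h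

theorem isSeparatingPair [CompleteSpace X] (hσ : σ.IsCCC) (hc : σ.IsLine c) (hA : IsOpen A)
    (hB : IsOpen B) (hAB : A ∪ B = Set.univ) {R : ℝ}
    (hR : ∀ x ∈ A ∩ B, infDist x (Set.range c) ≤ R) {ξ ζ : σ.Ray}
    (hξ : ξ.IsDeep (A \ Set.range c)) (hζ : ζ.IsDeep (B \ Set.range c)) (o : X) :
    IsSeparatingPair (σ.boundaryTopology o) hc.ray.toBoundary hc.neg.ray.toBoundary := by
  refine ⟨hc.toBoundary_ray_ne_neg, fun hconn => ?_⟩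
  let M := max R (infDist o (Set.range c))
  have hV : IsOpen {x | M < infDist x (Set.range c)} :=
    isOpen_lt continuous_const (continuous_infDist_pt _)
  obtain ⟨b, -, hbA, hbB⟩ := hconn _ _ (isOpen_shadow (hA.inter hV) o)
    (isOpen_shadow (hB.inter hV) o) (hc.compl_ends_subset hσ hAB M o)
    (hc.nonempty_shadow hσ hξ M o) (hc.nonempty_shadow hσ hζ M o)
  exact Set.disjoint_left.1 (hc.disjoint_shadow hσ.2 hA hB hAB
    (fun x hx => (hR x hx).trans (le_max_left _ _)) (le_max_right _ _)) hbA hbB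

end IsLine

end Separation

section Axes

variable {X : Type*} [MetricSpace X] {G : Type*} [Group G] [MulAction G X] {σ : Bicombing X}
  {g : G} {y : X}

/-- The midpoint of the `σ`-geodesic from `g⁻¹ • y` to `g • y`. -/
noncomputable def mid (σ : Bicombing X) (g : G) (y : X) : X := σ.seg (g⁻¹ • y) (g • y) (1 / 2)

theorem IsEquivariant.smul_mid (hequiv : σ.IsEquivariant G) (g h : G) (y : X) :
    h • σ.mid g y = σ.mid (h * g * h⁻¹) (h • y) := by
  simp only [mid, hequiv.smul_seg, smul_smul, mul_inv_rev, inv_inv, mul_assoc,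
    inv_mul_cancel, mul_one]

theorem IsEquivariant.seg_pow_smul_half (hequiv : σ.IsEquivariant G) (hy : σ.mid g y = y)
    (k : ℕ) : σ.seg (g ^ k • y) (g ^ (k + 2) • y) (1 / 2) = g ^ (k + 1) • y := by
  conv_rhs => rw [← hy, mid, hequiv.smul_seg, smul_smul, smul_smul, ← pow_succ, pow_succ,
    mul_inv_cancel_right]

/-- The path through the orbit of `y` under the powers of `g` that runs along the `σ`-geodesics from
`g ^ k • y` to `g ^ (k + 1) • y`, at unit time intervals. -/
noncomputable def orbitPath (σ : Bicombing X) (g : G) (y : X) (t : ℝ) : X :=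
  g ^ ⌊t⌋ • σ.seg y (g • y) (Int.fract t)

theorem orbitPath_add_intCast (σ : Bicombing X) (g : G) (y : X) (t : ℝ) (k : ℤ) :
    σ.orbitPath g y (t + k) = g ^ k • σ.orbitPath g y t := by
  rw [orbitPath, orbitPath, Int.floor_add_intCast, Int.fract_add_intCast, add_comm, zpow_add,
    mul_smul]

theorem seg_pow_smul_natCast_div (hσ : σ.IsCCC) (hequiv : σ.IsEquivariant G)
    (hy : σ.mid g y = y) {n k : ℕ} (hk : k ≤ n) : σ.seg y (g ^ n • y) (k / n) = g ^ k • y := by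
  rcases n.eq_zero_or_pos with rfl | hn
  · simp [Nat.le_zero.1 hk]
  have hn' : (0 : ℝ) < n := by exact_mod_cast hn
  have hhalf : (1 / 2 : ℝ) ∈ Set.Icc (0 : ℝ) 1 := by norm_num
  rw [← dist_le_zero]
  refine nonpos_of_midpoint_convex (f := fun k => dist (σ.seg y (g ^ n • y) (k / n)) (g ^ k • y))
    (by simp) (by simp [div_self hn'.ne']) (fun k hk => ?_) hk
  have hmid : σ.seg (σ.seg y (g ^ n • y) (k / n)) (σ.seg y (g ^ n • y) ((k + 2 : ℕ) / n)) (1 / 2) =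
      σ.seg y (g ^ n • y) ((k + 1 : ℕ) / n) := by
    rw [hσ.1.seg_seg _ _ (by positivity) (by gcongr; simp)
      (div_le_one_of_le₀ (Nat.cast_le.2 hk) hn'.le) hhalf]
    push_cast
    ring_nf
  have hle := hσ.2.dist_seg_le (σ.seg y (g ^ n • y) (k / n))
    (σ.seg y (g ^ n • y) ((k + 2 : ℕ) / n)) (g ^ k • y) (g ^ (k + 2) • y) hhalf
  rw [hmid, hequiv.seg_pow_smul_half hy] at hle
  linarith

theorem seg_pow_smul_div (hσ : σ.IsCCC) (hequiv : σ.IsEquivariant G) (hy : σ.mid g y = y)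
    {n : ℕ} {t : ℝ} (h0 : 0 ≤ t) (htn : t < n) :
    σ.seg y (g ^ n • y) (t / n) = σ.orbitPath g y t := by
  have hn : (0 : ℝ) < n := h0.trans_lt htn
  obtain ⟨k, hk⟩ := Int.eq_ofNat_of_zero_le (Int.floor_nonneg.2 h0)
  have hkt : (k : ℝ) + Int.fract t = t := by simpa [hk] using Int.floor_add_fract t
  have hkn : k + 1 ≤ n := by
    have : (k : ℝ) < n := by linarith [Int.fract_nonneg t]
    exact_mod_cast this
  have hseg := hσ.1.seg_seg y (g ^ n • y) (a := k / n) (b := (k + 1 : ℕ) / n) (by positivity)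
    (by gcongr; simp) (div_le_one_of_le₀ (Nat.cast_le.2 hkn) hn.le)
    ⟨Int.fract_nonneg t, (Int.fract_lt_one t).le⟩
  rw [seg_pow_smul_natCast_div hσ hequiv hy (by omega), seg_pow_smul_natCast_div hσ hequiv hy hkn,
    pow_succ, mul_smul, ← hequiv.smul_seg] at hseg
  rw [orbitPath, hk, zpow_natCast, hseg, ← hkt]
  push_cast
  congr 1
  field_simp
  simp

theorem dist_pow_smul (hσ : σ.IsCCC) (hequiv : σ.IsEquivariant G) (hy : σ.mid g y = y)
    (n : ℕ) : dist y (g ^ n • y) = n * dist y (g • y) := by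
  rcases n.eq_zero_or_pos with rfl | hn
  · simp
  have hn' : (1 : ℝ) ≤ n := by exact_mod_cast hn
  have hone := seg_pow_smul_natCast_div hσ hequiv hy (n := n) (k := 1) hn
  have hdist := σ.dist_left_seg y (g ^ n • y) (t := (1 : ℕ) / n)
    ⟨by positivity, div_le_one_of_le₀ (by simpa using hn') (by positivity)⟩
  rw [hone, pow_one] at hdist
  rw [hdist]
  field_simp
  simp

theorem dist_orbitPath_of_nonneg (hσ : σ.IsCCC) (hequiv : σ.IsEquivariant G)
    (hy : σ.mid g y = y) {a b : ℝ} (ha : 0 ≤ a) (hb : 0 ≤ b) :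
    dist (σ.orbitPath g y a) (σ.orbitPath g y b) = |a - b| * dist y (g • y) := by
  obtain ⟨n, hn⟩ := exists_nat_gt (max a b)
  obtain ⟨han, hbn⟩ := max_lt_iff.1 hn
  have hn0 : (0 : ℝ) < n := ha.trans_lt han
  rw [← seg_pow_smul_div hσ hequiv hy ha han, ← seg_pow_smul_div hσ hequiv hy hb hbn,
    σ.dist_seg_seg _ _ ⟨by positivity, div_le_one_of_le₀ han.le hn0.le⟩
      ⟨by positivity, div_le_one_of_le₀ hbn.le hn0.le⟩,
    dist_pow_smul hσ hequiv hy, ← sub_div, abs_div, abs_of_pos hn0]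
  field_simp

theorem seg_orbitPath_of_nonneg (hσ : σ.IsCCC) (hequiv : σ.IsEquivariant G)
    (hy : σ.mid g y = y) {a b u : ℝ} (ha : 0 ≤ a) (hab : a ≤ b) (hu : u ∈ Set.Icc (0 : ℝ) 1) :
    σ.seg (σ.orbitPath g y a) (σ.orbitPath g y b) u = σ.orbitPath g y (a + u * (b - a)) := by
  obtain ⟨n, hn⟩ := exists_nat_gt b
  have hn0 : (0 : ℝ) < n := (ha.trans hab).trans_lt hn
  have hub0 : 0 ≤ u * (b - a) := mul_nonneg hu.1 (sub_nonneg.2 hab)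
  have hub : u * (b - a) ≤ b - a := mul_le_of_le_one_left (sub_nonneg.2 hab) hu.2
  rw [← seg_pow_smul_div hσ hequiv hy ha (hab.trans_lt hn),
    ← seg_pow_smul_div hσ hequiv hy (ha.trans hab) hn,
    ← seg_pow_smul_div hσ hequiv hy (by linarith) (show a + u * (b - a) < n by linarith),
    hσ.1.seg_seg _ _ (by positivity) (by gcongr) (div_le_one_of_le₀ hn.le hn0.le) hu]
  ring_nf

theorem seg_orbitPath (hσ : σ.IsCCC) (hrev : σ.IsReversible) (hequiv : σ.IsEquivariant G)
    (hy : σ.mid g y = y) (a b : ℝ) {u : ℝ} (hu : u ∈ Set.Icc (0 : ℝ) 1) :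
    σ.seg (σ.orbitPath g y a) (σ.orbitPath g y b) u = σ.orbitPath g y (a + u * (b - a)) := by
  wlog hab : a ≤ b generalizing a b u
  · rw [hrev.seg_symm _ _ hu, this b a (Set.Icc.mem_iff_one_sub_mem.1 hu) (le_of_not_ge hab)]
    ring_nf
  have ha : 0 ≤ a + (-⌊a⌋ : ℤ) := by
    push_cast
    linarith [Int.floor_le a]
  have hseg := seg_orbitPath_of_nonneg hσ hequiv hy ha (by gcongr : _ ≤ b + (-⌊a⌋ : ℤ)) hu
  rw [add_sub_add_right_eq_sub, add_right_comm, orbitPath_add_intCast, orbitPath_add_intCast,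
    orbitPath_add_intCast, ← hequiv.smul_seg] at hseg
  exact smul_left_cancel _ hseg

theorem dist_orbitPath [IsIsometricSMul G X] (hσ : σ.IsCCC) (hequiv : σ.IsEquivariant G)
    (hy : σ.mid g y = y) (a b : ℝ) :
    dist (σ.orbitPath g y a) (σ.orbitPath g y b) = |a - b| * dist y (g • y) := by
  wlog hab : a ≤ b generalizing a b
  · rw [dist_comm, this b a (le_of_not_ge hab), abs_sub_comm]
  have ha : 0 ≤ a + (-⌊a⌋ : ℤ) := by
    push_cast
    linarith [Int.floor_le a]
  have hdist := dist_orbitPath_of_nonneg hσ hequiv hy ha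
    (ha.trans (by gcongr : _ ≤ b + (-⌊a⌋ : ℤ)))
  rwa [add_sub_add_right_eq_sub, orbitPath_add_intCast, orbitPath_add_intCast, dist_smul] at hdist

/-- The `σ`-line `c` is an axis of `g`, which translates it by `l > 0`. -/
structure IsAxis (σ : Bicombing X) (g : G) (c : ℝ → X) (l : ℝ) : Prop where
  isLine : σ.IsLine c
  pos : 0 < l
  smul_eq : ∀ t, g • c t = c (t + l)

theorem isAxis_orbitPath [IsIsometricSMul G X] (hσ : σ.IsCCC) (hrev : σ.IsReversible)
    (hequiv : σ.IsEquivariant G) (hy : σ.mid g y = y) (hgy : g • y ≠ y) :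
    σ.IsAxis g (fun t => σ.orbitPath g y (t / dist y (g • y))) (dist y (g • y)) where
  isLine.isometry := Isometry.of_dist_eq fun s t => by
    rw [dist_orbitPath hσ hequiv hy, ← sub_div, abs_div, abs_of_nonneg dist_nonneg,
      div_mul_cancel₀ _ (dist_ne_zero.2 hgy.symm), Real.dist_eq]
  isLine.seg_eq a b u hu := by
    rw [seg_orbitPath hσ hrev hequiv hy _ _ hu]
    ring_nf
  pos := dist_pos.2 hgy.symm
  smul_eq t := by
    have hadd := σ.orbitPath_add_intCast g y (t / dist y (g • y)) 1
    rw [zpow_one, Int.cast_one] at hadd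
    rw [← hadd, add_div, div_self (dist_ne_zero.2 hgy.symm)]

variable [IsIsometricSMul G X] {o : X}

theorem dist_zpow_smul_le (g : G) (o : X) (k : ℤ) :
    dist o (g ^ k • o) ≤ dist o (g • o) * |(k : ℝ)| := by
  have hpow : ∀ n : ℕ, dist o (g ^ n • o) ≤ dist o (g • o) * n := by
    intro n
    induction n with
    | zero => simp
    | succ n ih =>
      calc dist o (g ^ (n + 1) • o)
          ≤ dist o (g ^ n • o) + dist (g ^ n • o) (g ^ n • g • o) := by
            rw [pow_succ, mul_smul]
            exact dist_triangle _ _ _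
        _ ≤ dist o (g • o) * (n + 1 : ℕ) := by
            rw [dist_smul]
            push_cast
            linarith
  rcases k.eq_nat_or_neg with ⟨n, rfl | rfl⟩
  · simpa using hpow n
  · rw [zpow_neg, ← dist_smul (g ^ (n : ℤ)), smul_inv_smul, dist_comm]
    simpa using hpow n

theorem continuous_mid (σ : Bicombing X) (g : G) : Continuous (σ.mid g) :=
  σ.continuous_seg (isometry_smul X g⁻¹).continuous (isometry_smul X g).continuous continuous_const

theorem IsConical.dist_mid_mid_le (hσ : σ.IsConical) (g : G) (x y : X) :
    dist (σ.mid g x) (σ.mid g y) ≤ dist x y := by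
  have hle := hσ.dist_seg_le (g⁻¹ • x) (g • x) (g⁻¹ • y) (g • y) (t := 1 / 2) (by norm_num)
  rw [dist_smul, dist_smul] at hle
  exact hle.trans_eq (by ring)

theorem IsConical.dist_mid_le (hσ : σ.IsConical) (g : G) (x w : X) :
    dist (σ.mid g x) w ≤ (dist x (g • w) + dist x (g⁻¹ • w)) / 2 := by
  have hle := hσ.dist_seg_le (g⁻¹ • x) (g • x) w w (t := 1 / 2) (by norm_num)
  rw [seg_self, ← dist_smul g (g⁻¹ • x), ← dist_smul g⁻¹ (g • x), inv_smul_smul,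
    smul_inv_smul] at hle
  exact hle.trans_eq (by ring)

theorem exists_seg_mid_eq_self [CompleteSpace X] (hσ : σ.IsConical) (g : G) (o : X) {r : ℝ}
    (hr0 : 0 ≤ r) (hr1 : r < 1) : ∃ y, σ.seg o (σ.mid g y) r = y := by
  have hcontr : ContractingWith ⟨r, hr0⟩ fun y => σ.seg o (σ.mid g y) r := by
    refine ⟨hr1, LipschitzWith.of_dist_le_mul fun x y => ?_⟩
    calc dist (σ.seg o (σ.mid g x) r) (σ.seg o (σ.mid g y) r)
        ≤ r * dist (σ.mid g x) (σ.mid g y) := by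
          simpa using hσ.dist_seg_le o (σ.mid g x) o (σ.mid g y) ⟨hr0, hr1.le⟩
      _ ≤ r * dist x y := mul_le_mul_of_nonneg_left (hσ.dist_mid_mid_le g x y) hr0
  have : Nonempty X := ⟨o⟩
  exact ⟨_, hcontr.fixedPoint_isFixedPt⟩

theorem dist_smul_le_of_seg_mid_eq_self (hσ : σ.IsConical) (hequiv : σ.IsEquivariant G) {r : ℝ}
    (hr0 : 0 ≤ r) (hr1 : r < 1) (hy : σ.seg o (σ.mid g y) r = y) :
    dist y (g • y) ≤ dist o (g • o) := by
  have hgy : σ.seg (g • o) (σ.mid g (g • y)) r = g • y := by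
    conv_rhs => rw [← hy, hequiv.smul_seg, hequiv.smul_mid, mul_inv_cancel_right]
  have hle := hσ.dist_seg_le o (σ.mid g y) (g • o) (σ.mid g (g • y)) ⟨hr0, hr1.le⟩
  rw [hy, hgy] at hle
  have hmid := mul_le_mul_of_nonneg_left (hσ.dist_mid_mid_le g y (g • y)) hr0
  exact le_of_mul_le_mul_left (by linarith) (sub_pos.2 hr1)

theorem dist_le_of_seg_mid_eq_self (hσ : σ.IsConical) {q : ℝ} (hq0 : 0 < q) (hq1 : q ≤ 1)
    (hy : σ.seg o (σ.mid g y) (1 - q ^ 2) = y) : dist y o ≤ dist o (g • o) / q := by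
  have hr : 1 - q ^ 2 ∈ Set.Icc (0 : ℝ) 1 :=
    ⟨sub_nonneg.2 (pow_le_one₀ hq0.le hq1), sub_le_self _ (sq_nonneg q)⟩
  have hmid (k : ℤ) : dist (σ.mid g y) (g ^ k • o) ≤
      (dist y (g ^ (k + 1) • o) + dist y (g ^ (k - 1) • o)) / 2 := by
    have hle := hσ.dist_mid_le g y (g ^ k • o)
    rwa [smul_smul, smul_smul, mul_self_zpow, ← zpow_neg_one, ← zpow_add, neg_add_eq_sub]
      at hle
  have hf := le_div_of_le_resolvent (f := fun k : ℤ => dist y (g ^ k • o)) (A := dist y o) hq0 hq1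
    (dist_nonneg (x := o) (y := g • o))
    (fun k => (dist_triangle _ o _).trans (by gcongr; exact dist_zpow_smul_le g o k)) fun k => ?_
  · simpa using hf
  · calc dist y (g ^ k • o)
        ≤ (1 - (1 - q ^ 2)) * dist o (g ^ k • o) +
          (1 - q ^ 2) * dist (σ.mid g y) (g ^ k • o) := by
          simpa [hy] using hσ.dist_seg_le o (σ.mid g y) (g ^ k • o) (g ^ k • o) hr
      _ ≤ _ := by
          rw [sub_sub_cancel]
          exact add_le_add (mul_le_mul_of_nonneg_left (dist_zpow_smul_le g o k) (sq_nonneg q))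
            (mul_le_mul_of_nonneg_left (hmid k) hr.1)

theorem exists_dist_mid_le [CompleteSpace X] (hσ : σ.IsConical) (hequiv : σ.IsEquivariant G) (g : G)
    (o : X) {ε : ℝ} (hε : 0 < ε) :
    ∃ y, dist y (g • y) ≤ dist o (g • o) ∧ dist y (σ.mid g y) ≤ ε := by
  let l := dist o (g • o)
  have hl : 0 ≤ l := dist_nonneg
  obtain ⟨q, hq0, hq1, hq⟩ : ∃ q : ℝ, 0 < q ∧ q ≤ 1 ∧ q * (2 * l + 1) ≤ ε :=
    ⟨min 1 (ε / (2 * l + 1)), by positivity, min_le_left _ _,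
      (le_div_iff₀ (by positivity)).1 (min_le_right _ _)⟩
  have hr0 : 0 ≤ 1 - q ^ 2 := sub_nonneg.2 (pow_le_one₀ hq0.le hq1)
  have hr1 : 1 - q ^ 2 < 1 := sub_lt_self _ (by positivity)
  obtain ⟨y, hy⟩ := exists_seg_mid_eq_self hσ g o hr0 hr1
  refine ⟨y, dist_smul_le_of_seg_mid_eq_self hσ hequiv hr0 hr1 hy, ?_⟩
  have hyo : dist y o ≤ l / q := dist_le_of_seg_mid_eq_self hσ hq0 hq1 hy
  have hmid : dist o (σ.mid g y) ≤ l / q + l := by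
    have hgo := dist_triangle y o (g • o)
    have hgo' := dist_triangle y o (g⁻¹ • o)
    have hg : dist o (g⁻¹ • o) ≤ l := by simpa using dist_zpow_smul_le g o (-1)
    linarith [hσ.dist_mid_le g y o, dist_comm o (σ.mid g y)]
  have hdist : dist y (σ.mid g y) = q ^ 2 * dist o (σ.mid g y) := by
    have := σ.dist_seg_seg o (σ.mid g y) ⟨hr0, hr1.le⟩ (Set.right_mem_Icc.2 zero_le_one)
    rwa [hy, seg_one, sub_sub_cancel_left, abs_neg, abs_of_nonneg (sq_nonneg q)] at this
  calc dist y (σ.mid g y) ≤ q ^ 2 * (l / q + l) := by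
        rw [hdist]
        exact mul_le_mul_of_nonneg_left hmid (sq_nonneg q)
    _ = q * l + q * (q * l) := by field_simp
    _ ≤ q * l + q * l := by gcongr; exact mul_le_of_le_one_left hl hq1
    _ ≤ ε := by linarith

theorem exists_conj_dist_mid_le [CompleteSpace X] (hσ : σ.IsConical) (hequiv : σ.IsEquivariant G)
    {D : ℝ} (hD : ∀ x : X, ∃ k : G, dist x (k • o) ≤ D) (g : G) {ε : ℝ} (hε : 0 < ε) :
    ∃ h, IsConj h g ∧ dist o (h • o) ≤ D + dist o (g • o) + D ∧
      ∃ x ∈ Metric.closedBall o D, dist x (σ.mid h x) ≤ ε := by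
  obtain ⟨y, hgy, hy⟩ := exists_dist_mid_le hσ hequiv g o hε
  obtain ⟨k, hk⟩ := hD y
  have hx : dist (k⁻¹ • y) o ≤ D := by rwa [← dist_smul k, smul_inv_smul]
  have hmid : σ.mid (k⁻¹ * g * k) (k⁻¹ • y) = k⁻¹ • σ.mid g y := by
    rw [hequiv.smul_mid, inv_inv]
  refine ⟨k⁻¹ * g * k, isConj_iff.2 ⟨k, by group⟩, ?_, k⁻¹ • y, hx, by rwa [hmid, dist_smul]⟩
  have hdisp : (k⁻¹ * g * k) • k⁻¹ • y = k⁻¹ • g • y := by simp [smul_smul, mul_assoc]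
  calc dist o ((k⁻¹ * g * k) • o)
      ≤ dist o (k⁻¹ • y) + dist (k⁻¹ • y) ((k⁻¹ * g * k) • k⁻¹ • y) +
        dist ((k⁻¹ * g * k) • k⁻¹ • y) ((k⁻¹ * g * k) • o) := dist_triangle4 _ _ _ _
    _ ≤ D + dist o (g • o) + D := by
      rw [dist_smul (k⁻¹ * g * k), hdisp, dist_smul, dist_comm o]
      gcongr

end Axes

section GeometricAction

variable {X : Type*} [MetricSpace X] [ProperSpace X] [Nonempty X] {G : Type*} [Group G]
  [MulAction G X] {σ : Bicombing X}

theorem exists_mid_eq_self (hGX : IsGeometricAction G X)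
    (hσ : σ.IsConical) (hequiv : σ.IsEquivariant G) (g : G) : ∃ y, σ.mid g y = y := by
  have := hGX.isIsometricSMul
  obtain ⟨o⟩ := ‹Nonempty X›
  obtain ⟨D, hD⟩ := hGX.exists_dist_smul_le o
  -- Only finitely many conjugates of `g` compete for almost fixing a point near `o`.
  let T := {h | IsConj h g ∧ dist o (h • o) ≤ D + dist o (g • o) + D}
  have hT : T.Finite := (hGX.finite_dist_smul_le o _).subset fun h hh => hh.2
  have hclosed : IsClosed (⋃ h ∈ T, (fun x => dist x (σ.mid h x)) '' Metric.closedBall o D) :=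
    (hT.isCompact_biUnion fun h _ => (isCompact_closedBall o D).image
      (continuous_id.dist (σ.continuous_mid h))).isClosed
  have hzero : (0 : ℝ) ∈ ⋃ h ∈ T, (fun x => dist x (σ.mid h x)) '' Metric.closedBall o D := by
    refine hclosed.closure_subset (Metric.mem_closure_iff.2 fun ε hε => ?_)
    obtain ⟨h, hhg, hho, x, hx, hxε⟩ := exists_conj_dist_mid_le hσ hequiv hD g (half_pos hε)
    refine ⟨dist x (σ.mid h x), Set.mem_biUnion (x := h) ⟨hhg, hho⟩ ⟨x, hx, rfl⟩, ?_⟩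
    rw [dist_zero_left, Real.norm_of_nonneg dist_nonneg]
    linarith
  simp only [Set.mem_iUnion] at hzero
  obtain ⟨h, ⟨hhg, -⟩, x, -, hx⟩ := hzero
  obtain ⟨k, rfl⟩ := isConj_iff.1 hhg
  exact ⟨k • x, by rw [← hequiv.smul_mid, ← dist_eq_zero.1 hx]⟩

theorem exists_isAxis (hGX : IsGeometricAction G X) (hσ : σ.IsCCC) (hrev : σ.IsReversible)
    (hequiv : σ.IsEquivariant G) {g : G} (hg : ¬ IsOfFinOrder g) : ∃ c l, σ.IsAxis g c l := by
  have := hGX.isIsometricSMul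
  obtain ⟨y, hy⟩ := exists_mid_eq_self hGX hσ.2 hequiv g
  exact ⟨_, _, isAxis_orbitPath hσ hrev hequiv hy fun hgy => hg (hGX.isOfFinOrder_of_smul_eq hgy)⟩

end GeometricAction

section AxisNeighbourhoods

open Metric

variable {X : Type*} [MetricSpace X] {G : Type*} [Group G] [MulAction G X] {σ : Bicombing X}
  {γ h : G} {c c' : ℝ → X} {l l' : ℝ}

namespace IsAxis

theorem pow_smul_eq (hc : σ.IsAxis γ c l) (n : ℕ) (t : ℝ) : γ ^ n • c t = c (t + n * l) := by
  induction n with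
  | zero => simp
  | succ n ih =>
    rw [pow_succ', mul_smul, ih, hc.smul_eq]
    push_cast
    ring_nf

theorem zpow_smul_eq (hc : σ.IsAxis γ c l) (k : ℤ) (t : ℝ) : γ ^ k • c t = c (t + k * l) := by
  rcases k.eq_nat_or_neg with ⟨n, rfl | rfl⟩
  · simpa using hc.pow_smul_eq n t
  · rw [zpow_neg, inv_smul_eq_iff, zpow_natCast, hc.pow_smul_eq]
    push_cast
    ring_nf

theorem exists_dist_zpow_smul_le (hc : σ.IsAxis γ c l) (s : ℝ) :
    ∃ k : ℤ, dist (c s) (γ ^ k • c 0) ≤ l := by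
  refine ⟨⌊s / l⌋, ?_⟩
  have hfract : s - ⌊s / l⌋ * l = Int.fract (s / l) * l := by
    rw [Int.fract, sub_mul, div_mul_cancel₀ _ hc.pos.ne']
  rw [hc.zpow_smul_eq, hc.isLine.dist_eq, zero_add, hfract, abs_of_nonneg
    (mul_nonneg (Int.fract_nonneg _) hc.pos.le)]
  exact mul_le_of_le_one_left hc.pos.le (Int.fract_lt_one _).le

variable [IsIsometricSMul G X] {U S : Set G} {o : X} {D : ℝ}

theorem isCosetFinite_infDist_le (hc : σ.IsAxis γ c l)
    (hfin : ∀ R : ℝ, {g : G | dist o (g • o) ≤ R}.Finite) (R : ℝ) :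
    IsCosetFinite (Subgroup.zpowers γ) {g | infDist (g • o) (Set.range c) ≤ R} := by
  refine ⟨_, hfin (dist o (c 0) + l + (R + 1)), fun g hg => ?_⟩
  obtain ⟨s, hs⟩ : ∃ s, dist (g • o) (c s) < R + 1 := by
    simpa using (infDist_lt_iff (Set.range_nonempty c)).1 (hg.trans_lt (lt_add_one R))
  obtain ⟨k, hk⟩ := hc.exists_dist_zpow_smul_le s
  refine ⟨γ ^ k, Subgroup.zpow_mem_zpowers γ k, (γ ^ k)⁻¹ * g, ?_, mul_inv_cancel_left _ _⟩
  rw [Set.mem_ofPred_eq, ← dist_smul (γ ^ k), mul_smul, smul_inv_smul]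
  calc dist (γ ^ k • o) (g • o)
      ≤ dist (γ ^ k • o) (γ ^ k • c 0) + dist (γ ^ k • c 0) (c s) + dist (c s) (g • o) :=
        dist_triangle4 _ _ _ _
    _ ≤ dist o (c 0) + l + (R + 1) := by
        rw [dist_smul, dist_comm _ (c s), dist_comm (c s) (g • o)]
        gcongr

theorem exists_infDist_le (hc : σ.IsAxis γ c l) (hS : IsCosetFinite (Subgroup.zpowers γ) S)
    (o : X) : ∃ R, ∀ g ∈ S, infDist (g • o) (Set.range c) ≤ R := by
  obtain ⟨F, hF, hSF⟩ := hS
  obtain ⟨R, hR⟩ := (hF.image fun f => dist (f • o) (c 0)).bddAbove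
  refine ⟨R, fun g hg => ?_⟩
  obtain ⟨_, ⟨k, rfl⟩, f, hf, rfl⟩ := hSF hg
  calc infDist ((γ ^ k * f) • o) (Set.range c) ≤ dist ((γ ^ k * f) • o) (γ ^ k • c 0) :=
        infDist_le_dist_of_mem (hc.zpow_smul_eq k 0 ▸ Set.mem_range_self _)
    _ ≤ R := by
        rw [mul_smul, dist_smul]
        exact hR ⟨f, hf, rfl⟩

theorem exists_infDist_le_of_mem_thickening (hc : σ.IsAxis γ c l)
    (hfin : ∀ R : ℝ, {g : G | dist o (g • o) ≤ R}.Finite)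
    (hU : IsAlmostInvariant (Subgroup.zpowers γ) U) (D : ℝ) :
    ∃ R, ∀ x ∈ thickening D ((· • o) '' U) ∩ thickening D ((· • o) '' Uᶜ),
      infDist x (Set.range c) ≤ R := by
  obtain ⟨R, hR⟩ := hc.exists_infDist_le (hU.isCosetFinite_dist_le (hfin (D + D))) o
  refine ⟨R + D, fun x ⟨hx, hx'⟩ => ?_⟩
  obtain ⟨_, ⟨g, hg, rfl⟩, hxg⟩ := mem_thickening_iff.1 hx
  obtain ⟨_, ⟨g', hg', rfl⟩, hxg'⟩ := mem_thickening_iff.1 hx'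
  have hgg' : dist (g • o) (g' • o) ≤ D + D :=
    (dist_triangle_left _ _ x).trans (add_le_add hxg.le hxg'.le)
  calc infDist x (Set.range c) ≤ infDist (g • o) (Set.range c) + dist x (g • o) :=
        infDist_le_infDist_add_dist
    _ ≤ R + D := add_le_add (hR g ⟨hg, g', hg', hgg'⟩) hxg.le

theorem isDeep_ray (hc : σ.IsAxis γ c l) (hc' : σ.IsAxis h c' l')
    (hfin : ∀ R : ℝ, {g : G | dist o (g • o) ≤ R}.Finite)
    (hU : IsAlmostInvariant (Subgroup.zpowers γ) U)
    (hh : ∀ n : ℕ, h ^ (n + 1) ∈ U \ Subgroup.zpowers γ)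
    (hcover : thickening D ((· • o) '' U) ∪ thickening D ((· • o) '' Uᶜ) = Set.univ) :
    hc'.isLine.ray.IsDeep (thickening D ((· • o) '' U) \ Set.range c) := by
  intro C
  -- Only finitely many cosets of `⟨γ⟩` give orbit points near the axis of `γ` or near `Uᶜ • o`.
  obtain ⟨n, hn⟩ := ((hU.isCosetFinite_dist_le (hfin (dist o (c' 0) + C + D))).union
    (hc.isCosetFinite_infDist_le hfin (dist o (c' 0) + C))).exists_pow_notMem fun n => (hh n).2
  obtain ⟨hfarU, hfarc⟩ := not_or.1 hn
  have hray : hc'.isLine.ray ((n + 1 : ℕ) * l'.toNNReal) = h ^ (n + 1) • c' 0 := by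
    rw [hc'.pow_smul_eq, IsLine.ray_apply, NNReal.coe_mul, Real.coe_toNNReal _ hc'.pos.le, zero_add,
      NNReal.coe_natCast]
  refine ⟨(n + 1 : ℕ) * l'.toNNReal, fun x hx => ?_⟩
  have hxo : dist (h ^ (n + 1) • o) x ≤ dist o (c' 0) + C := by
    rw [hray, mem_closedBall'] at hx
    exact (dist_triangle _ (h ^ (n + 1) • c' 0) _).trans (by rw [dist_smul]; gcongr)
  constructor
  · refine (hcover.ge (Set.mem_univ x)).resolve_right fun hxU => hfarU ⟨(hh n).1, ?_⟩
    obtain ⟨_, ⟨g', hg', rfl⟩, hxg'⟩ := mem_thickening_iff.1 hxU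
    exact ⟨g', hg', (dist_triangle _ x _).trans (add_le_add hxo hxg'.le)⟩
  · exact fun hxc => hfarc ((infDist_le_dist_of_mem hxc).trans hxo)

end IsAxis

theorem thickening_smul_union_compl {o : X} {D : ℝ} (hD : ∀ x : X, ∃ g : G, dist x (g • o) < D)
    (U : Set G) : thickening D ((· • o) '' U) ∪ thickening D ((· • o) '' Uᶜ) = Set.univ := by
  refine Set.eq_univ_of_forall fun x => ?_
  obtain ⟨g, hg⟩ := hD x
  exact (em (g ∈ U)).imp (fun hgU => mem_thickening_iff.2 ⟨_, ⟨g, hgU, rfl⟩, hg⟩)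
    fun hgU => mem_thickening_iff.2 ⟨_, ⟨g, hgU, rfl⟩, hg⟩

end AxisNeighbourhoods

theorem exists_isSeparatingPair_of_isAlmostInvariant {G X : Type*} [Group G] [MetricSpace X]
    [ProperSpace X] [Nonempty X] [MulAction G X] (hGX : IsGeometricAction G X) {σ : Bicombing X}
    (hσ : σ.IsCCC) (hrev : σ.IsReversible) (hequiv : σ.IsEquivariant G) {γ : G}
    (hγ : ¬ IsOfFinOrder γ) {U : Set G} (hU : IsAlmostInvariant (Subgroup.zpowers γ) U)
    (hg : ∃ g, ∀ n : ℕ, g ^ (n + 1) ∈ U \ Subgroup.zpowers γ)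
    (hh : ∃ h, ∀ n : ℕ, h ^ (n + 1) ∈ Uᶜ \ Subgroup.zpowers γ) :
    ∃ a b : σ.Boundary, ∀ o : X, IsSeparatingPair (σ.boundaryTopology o) a b := by
  have := hGX.isIsometricSMul
  obtain ⟨p⟩ := ‹Nonempty X›
  obtain ⟨D, hD⟩ := hGX.exists_dist_smul_le p
  have hfin := hGX.finite_dist_smul_le p
  obtain ⟨g, hg⟩ := hg
  obtain ⟨h, hh⟩ := hh
  obtain ⟨c, l, hc⟩ := exists_isAxis hGX hσ hrev hequiv hγ
  obtain ⟨cg, lg, hcg⟩ := exists_isAxis hGX hσ hrev hequiv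
    (not_isOfFinOrder_of_forall_pow_notMem fun n => (hg n).2)
  obtain ⟨ch, lh, hch⟩ := exists_isAxis hGX hσ hrev hequiv
    (not_isOfFinOrder_of_forall_pow_notMem fun n => (hh n).2)
  have hcover := thickening_smul_union_compl (fun x => (hD x).imp fun _ hk =>
    hk.trans_lt (lt_add_one D)) U
  obtain ⟨R, hR⟩ := hc.exists_infDist_le_of_mem_thickening hfin hU (D + 1)
  exact ⟨_, _, hc.isLine.isSeparatingPair hσ Metric.isOpen_thickening Metric.isOpen_thickening
    hcover hR (hc.isDeep_ray hcg hfin hU hg hcover)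
    (hc.isDeep_ray hch hfin hU.compl hh (by rwa [compl_compl, Set.union_comm]))⟩

end Bicombing

theorem propositionp {G : Type*} [Group G] (G₁ G₂ Z : Subgroup G)
    (hG : IsAmalgamatedProduct G₁ G₂ Z) (h₁ : G₁ ≠ Z) (h₂ : G₂ ≠ Z) (hZ : IsVirtuallyInt Z)
    {X : Type*} [MetricSpace X] [ProperSpace X] [Nonempty X] [MulAction G X]
    (hGX : IsGeometricAction G X)
    (σ : Bicombing X) (hσ : σ.IsCCC) (hrev : σ.IsReversible) (hequiv : σ.IsEquivariant G) :
    ∃ a b : σ.Boundary, ∀ o : X, IsSeparatingPair (σ.boundaryTopology o) a b := by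
  obtain ⟨γ, hγZ, hγ, hγfin⟩ := hZ.exists_isCosetFinite_zpowers
  obtain ⟨U, hU, ⟨g, hg⟩, ⟨h, hh⟩⟩ := hG.exists_isAlmostInvariant h₁ h₂
  have hle : Subgroup.zpowers γ ≤ Z := Subgroup.zpowers_le.2 hγZ
  exact Bicombing.exists_isSeparatingPair_of_isAlmostInvariant hGX hσ hrev hequiv hγ
    (hU.trans hγfin) ⟨g, fun n => ⟨(hg n).1, fun hgn => (hg n).2 (hle hgn)⟩⟩
    ⟨h, fun n => ⟨(hh n).1, fun hhn => (hh n).2 (hle hhn)⟩⟩
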